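/- **Theorem.** Let $X$ be a locally compact Hausdorff space, let $\varphi : G\to \mathrm{Homeo}(X)$ be an action of a discrete group $G$, and let $\alpha_s(a)=a\circ\varphi_{s^{-1}}$ be the corresponding action of $G$ on $C_0(X)$. Let $u$ be a normalised $2$-cocycle with values in the group $C_u(X)$ of continuous maps $X\to\mathbb T$, that is, $u:G\times G\to C_u(X)$ satisfies $u(1,1)=1$ and $$\alpha_r(u(s,t))\,u(r,st)=u(r,s)\,u(rs,t)\qquad (r,s,t\in G).$$ Let $F(\alpha,u)=\ell^1(G,C_0(X))$ be the Banach algebra with the product $(a*b)(r)=\sum_{st=r}a(s)\,\alpha_s(b(t))\,u(s,t)$. It contains $C_0(X)$ via $a\mapsto a\delta_1$. For $p\in[1,\infty]$ let $\|b\|_{L^p}$ be the supremum of $\|\psi(b)\|$ over all non-degenerate contractive representations $\psi$ of $F(\alpha,u)$ on Banach spaces isometrically isomorphic to some $L^p(\mu)$ if $p<\infty$, respectively to some $C_0(\Omega)$, $\Omega$ a topological space, if $p=\infty$. Let $\|b\|_{L^p,\mathrm r}=\|\Lambda_p(b)\|$, where $\Lambda_p$ is the regular representation of $F(\alpha,u)$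 on $\ell^p(X\times G)$ (on $c_0(X\times G)$ if $p=\infty$) given by $$\Lambda_p(b)\xi(x,t)=\sum_{s\in G}b(s)(x)\,u(s,s^{-1}t)(x)\,\xi(\varphi_{s^{-1}}(x),s^{-1}t).$$ For $\emptyset\ne P\subseteq[1,\infty]$ let $F^P(\alpha,u)$ and $F^P_{\mathrm r}(\alpha,u)$ be the completions of $F(\alpha,u)$ in the norms $\sup_{p\in P}\|\cdot\|_{L^p}$ and $\sup_{p\in P}\|\cdot\|_{L^p,\mathrm r}$, and let $\Lambda_P:F^P(\alpha,u)\to F^P_{\mathrm r}(\alpha,u)$ be the continuous extension of the identity of $F(\alpha,u)$; put $F^\emptyset(\alpha,u)=F^\emptyset_{\mathrm r}(\alpha,u)=F(\alpha,u)$ and $\Lambda_\emptyset=\mathrm{id}$. For a subgroup $H\subseteq G$ the same constructions apply to the restricted twisted action $(\alpha|_H,u|_H)$ of $H$. By an ideal of a Banach algebra we mean a closed two-sided ideal. A subalgebra $A\subseteq B$ has the *generalised intersection property with hidden ideal $K$* if $K$ is the largest ideal of $B$ with $K\cap A=\{0\}$, and $A$ *detects ideals* in $B$ if $J\cap A\neq\{0\}$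 for every non-zero ideal $J$ of $B$. The action $\varphi$ is *topologically free* if for every $t\in G\setminus\{1\}$ the set $\{x\in X:\varphi_t(x)=x\}$ has empty interior. Then for every $P\subseteq[1,\infty]$ the following conditions are equivalent: 1. $\varphi$ is topologically free. 2. For every subgroup $H\subseteq G$, $C_0(X)\subseteq F^P(\alpha|_H,u|_H)$ has the generalised intersection property with hidden ideal $\ker\big(\Lambda_P:F^P(\alpha|_H,u|_H)\to F^P_{\mathrm r}(\alpha|_H,u|_H)\big)$. 3. For every subgroup $H\subseteq G$, $C_0(X)$ detects ideals in $F^P_{\mathrm r}(\alpha|_H,u|_H)$. 4. For every cyclic subgroup $H\subseteq G$, $C_0(X)$ detects ideals in $F^P_{\mathrm r}(\alpha|_H,u|_H)$. -/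

import Mathlib

set_option linter.unusedSectionVars false

noncomputable section

namespace TwistedCrossedProduct

open Filter Topology UniformSpace MeasureTheory
open scoped ZeroAtInfty ENNReal lp Pointwise

universe u v w

/-! ### Twisted actions -/

/-- A normalised 2-cocycle of `G` with values in `C_u(X)`, the unitary group of `C_b(X)`, written as
the group of continuous maps `X → 𝕋`. The group `G` acts on `X` by homeomorphisms, and on functions
by `α_s(a)(x) = a(s⁻¹ • x)`. -/
structure Twist (G : Type v) (X : Type u) [Group G] [TopologicalSpace X] [MulAction G X] where
  /-- the cocycle `u : G × G → C_u(X)` -/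
  toFun : G → G → C(X, Circle)
  /-- the cocycle identity `α_r(u(s,t)) u(r,st) = u(r,s) u(rs,t)` -/
  cocycle : ∀ (r s t : G) (x : X),
    toFun s t (r⁻¹ • x) * toFun r (s * t) x = toFun r s x * toFun (r * s) t x
  /-- `u(1,1) = 1` -/
  normalised : toFun 1 1 = 1

variable {G : Type v} {X : Type u} [Group G] [TopologicalSpace X] [MulAction G X]

/-- The restriction of a twist to a subgroup. -/
def Twist.restrict (u : Twist G X) (H : Subgroup G) : Twist H X where
  toFun s t := u.toFun s t
  cocycle r s t x := u.cocycle r s t x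
  normalised := u.normalised

lemma Twist.one_left (u : Twist G X) (t : G) (x : X) : u.toFun 1 t x = 1 := by
  have h := u.cocycle 1 1 t x
  simpa [u.normalised] using h

lemma Twist.one_right (u : Twist G X) (t : G) (x : X) : u.toFun t 1 x = 1 := by
  have h := u.cocycle t 1 1 x
  simpa [u.normalised] using h

variable (G X) in
/-- The action of `G` on `X` is topologically free: the fixed point sets of all `t ≠ 1` have empty
interiors. -/
def IsTopologicallyFree : Prop :=
  ∀ t : G, t ≠ 1 → interior {x : X | t • x = x} = ∅

variable [ContinuousConstSMul G X]

instance (H : Subgroup G) : ContinuousConstSMul H X :=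
  ⟨fun h => continuous_const_smul (h : G)⟩

/-- The automorphism `α_s` of `C_0(X)`, `α_s(a)(x) = a(s⁻¹ • x)`. -/
def translate (s : G) (a : C₀(X, ℂ)) : C₀(X, ℂ) :=
  a.comp (Homeomorph.smul s⁻¹ : X ≃ₜ X).toCocompactMap

/-- The product `a w` of `a ∈ C_0(X)` with a unitary function `w ∈ C_u(X)`. -/
def mulUnitary (a : C₀(X, ℂ)) (w : C(X, Circle)) : C₀(X, ℂ) where
  toFun x := a x * (w x : ℂ)
  continuous_toFun := by fun_prop
  zero_at_infty' := by
    have h := (zero_at_infty a).norm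
    rw [tendsto_zero_iff_norm_tendsto_zero]
    simp only [norm_mul, Circle.norm_coe, mul_one]
    simpa using h

@[simp] lemma translate_apply (s : G) (a : C₀(X, ℂ)) (x : X) : translate s a x = a (s⁻¹ • x) := rfl

@[simp] lemma mulUnitary_apply (a : C₀(X, ℂ)) (w : C(X, Circle)) (x : X) :
    mulUnitary a w x = a x * (w x : ℂ) := rfl

lemma norm_apply_le (a : C₀(X, ℂ)) (x : X) : ‖a x‖ ≤ ‖a‖ := by
  rw [← ZeroAtInftyContinuousMap.norm_toBCF_eq_norm]
  exact a.toBCF.norm_coe_le_norm x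

lemma norm_le_of_apply {a : C₀(X, ℂ)} {C : ℝ} (hC : 0 ≤ C) (h : ∀ x, ‖a x‖ ≤ C) : ‖a‖ ≤ C := by
  rw [← ZeroAtInftyContinuousMap.norm_toBCF_eq_norm]
  exact (BoundedContinuousFunction.norm_le hC).2 h

/-! ### The universal Banach algebra crossed product -/

/-- The coefficient `a α_s(b) u(s,t)` of the product `(a δ_s)(b δ_t)`. -/
def coeffMul (u : Twist G X) (s t : G) (a b : C₀(X, ℂ)) : C₀(X, ℂ) :=
  mulUnitary (a * translate s b) (u.toFun s t)

@[simp] lemma coeffMul_apply (u : Twist G X) (s t : G) (a b : C₀(X, ℂ)) (x : X) :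
    coeffMul u s t a b x = a x * b (s⁻¹ • x) * (u.toFun s t x : ℂ) := rfl

lemma norm_coeffMul_le (u : Twist G X) (s t : G) (a b : C₀(X, ℂ)) :
    ‖coeffMul u s t a b‖ ≤ ‖a‖ * ‖b‖ := by
  refine norm_le_of_apply (by positivity) fun x => ?_
  simp only [coeffMul_apply, norm_mul, Circle.norm_coe, mul_one]
  exact mul_le_mul (norm_apply_le a x) (norm_apply_le b _) (norm_nonneg _) (norm_nonneg _)

lemma coeffMul_add_left (u : Twist G X) (s t : G) (a a' b : C₀(X, ℂ)) :
    coeffMul u s t (a + a') b = coeffMul u s t a b + coeffMul u s t a' b := by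
  ext x; simp; ring

lemma coeffMul_add_right (u : Twist G X) (s t : G) (a b b' : C₀(X, ℂ)) :
    coeffMul u s t a (b + b') = coeffMul u s t a b + coeffMul u s t a b' := by
  ext x; simp; ring

lemma coeffMul_smul_left (u : Twist G X) (s t : G) (c : ℂ) (a b : C₀(X, ℂ)) :
    coeffMul u s t (c • a) b = c • coeffMul u s t a b := by
  ext x; simp; ring

lemma coeffMul_smul_right (u : Twist G X) (s t : G) (c : ℂ) (a b : C₀(X, ℂ)) :
    coeffMul u s t a (c • b) = c • coeffMul u s t a b := by
  ext x; simp; ring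

/-- The underlying Banach space `ℓ¹(G, C_0(X))` of `F(α,u)`; its product depends on the twist. -/
def UniversalAlgebra (_u : Twist G X) : Type (max u v) := ↥(lp (fun _ : G => C₀(X, ℂ)) 1)

variable (u : Twist G X)

instance : NormedAddCommGroup (UniversalAlgebra u) :=
  inferInstanceAs (NormedAddCommGroup ↥(lp (fun _ : G => C₀(X, ℂ)) 1))

instance : NormedSpace ℂ (UniversalAlgebra u) :=
  inferInstanceAs (NormedSpace ℂ ↥(lp (fun _ : G => C₀(X, ℂ)) 1))

instance : CompleteSpace (UniversalAlgebra u) :=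
  inferInstanceAs (CompleteSpace ↥(lp (fun _ : G => C₀(X, ℂ)) 1))

instance : CoeFun (UniversalAlgebra u) fun _ => G → C₀(X, ℂ) :=
  ⟨fun a => (show ↥(lp (fun _ : G => C₀(X, ℂ)) 1) from a : G → C₀(X, ℂ))⟩

variable {u}

namespace UniversalAlgebra

@[ext] lemma ext {a b : UniversalAlgebra u} (h : ∀ r, a r = b r) : a = b := lp.ext (funext h)

@[simp] lemma add_apply (a b : UniversalAlgebra u) (r : G) : (a + b) r = a r + b r := rfl

@[simp] lemma smul_apply (c : ℂ) (a : UniversalAlgebra u) (r : G) : (c • a) r = c • a r := rfl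

lemma summable_norm (a : UniversalAlgebra u) : Summable fun s => ‖a s‖ := by
  have h := (lp.memℓp (show ↥(lp (fun _ : G => C₀(X, ℂ)) 1) from a)).summable (by norm_num)
  simp only [ENNReal.toReal_one, Real.rpow_one] at h
  exact h

lemma norm_eq (a : UniversalAlgebra u) : ‖a‖ = ∑' s, ‖a s‖ := by
  have h := lp.norm_eq_tsum_rpow (p := 1) (by norm_num)
    (show ↥(lp (fun _ : G => C₀(X, ℂ)) 1) from a)
  simp only [ENNReal.toReal_one, Real.rpow_one, div_one] at h
  exact h

/-- An absolutely summable family of coefficients, as an element of `F(α,u)`. -/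
def mk (f : G → C₀(X, ℂ)) (hf : Summable fun s => ‖f s‖) : UniversalAlgebra u :=
  (⟨f, memℓp_gen (by simpa using hf)⟩ : ↥(lp (fun _ : G => C₀(X, ℂ)) 1))

@[simp] lemma mk_apply (f : G → C₀(X, ℂ)) (hf : Summable fun s => ‖f s‖) (r : G) :
    (mk f hf : UniversalAlgebra u) r = f r := rfl

lemma summable_prod (a b : UniversalAlgebra u) :
    Summable fun q : G × G => ‖a q.2‖ * ‖b (q.2⁻¹ * q.1)‖ := by
  have h := a.summable_norm.mul_of_nonneg b.summable_norm (fun _ => norm_nonneg _)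
    (fun _ => norm_nonneg _)
  let e : G × G ≃ G × G :=
    ⟨fun q => (q.2, q.2⁻¹ * q.1), fun q => (q.1 * q.2, q.1), fun q => by simp, fun q => by simp⟩
  exact (e.summable_iff (f := fun q : G × G => ‖a q.1‖ * ‖b q.2‖)).2 h

lemma tsum_prod (a b : UniversalAlgebra u) :
    ∑' q : G × G, ‖a q.2‖ * ‖b (q.2⁻¹ * q.1)‖ = ‖a‖ * ‖b‖ := by
  let e : G × G ≃ G × G :=
    ⟨fun q => (q.2, q.2⁻¹ * q.1), fun q => (q.1 * q.2, q.1), fun q => by simp, fun q => by simp⟩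
  have h := e.tsum_eq (fun q : G × G => ‖a q.1‖ * ‖b q.2‖)
  refine h.trans ?_
  rw [norm_eq, norm_eq]
  refine (a.summable_norm.tsum_mul_tsum b.summable_norm ?_).symm
  exact a.summable_norm.mul_of_nonneg b.summable_norm (fun _ => norm_nonneg _)
    (fun _ => norm_nonneg _)

lemma summable_coeff_norm (a b : UniversalAlgebra u) (r : G) :
    Summable fun s => ‖coeffMul u s (s⁻¹ * r) (a s) (b (s⁻¹ * r))‖ :=
  Summable.of_nonneg_of_le (fun _ => norm_nonneg _) (fun _ => norm_coeffMul_le u _ _ _ _)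
    ((summable_prod a b).prod_factor r)

lemma summable_coeff (a b : UniversalAlgebra u) (r : G) :
    Summable fun s => coeffMul u s (s⁻¹ * r) (a s) (b (s⁻¹ * r)) :=
  (summable_coeff_norm a b r).of_norm

lemma norm_conv_le (a b : UniversalAlgebra u) (r : G) :
    ‖∑' s, coeffMul u s (s⁻¹ * r) (a s) (b (s⁻¹ * r))‖ ≤ ∑' s, ‖a s‖ * ‖b (s⁻¹ * r)‖ :=
  (norm_tsum_le_tsum_norm (summable_coeff_norm a b r)).trans
    ((summable_coeff_norm a b r).tsum_le_tsum (fun _ => norm_coeffMul_le u _ _ _ _)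
      ((summable_prod a b).prod_factor r))

lemma summable_norm_conv (a b : UniversalAlgebra u) :
    Summable fun r => ‖∑' s, coeffMul u s (s⁻¹ * r) (a s) (b (s⁻¹ * r))‖ :=
  Summable.of_nonneg_of_le (fun _ => norm_nonneg _) (norm_conv_le a b) (summable_prod a b).prod

/-- The product `(a * b)(r) = ∑_{st = r} a(s) α_s(b(t)) u(s,t)`. -/
instance : Mul (UniversalAlgebra u) :=
  ⟨fun a b => mk (fun r => ∑' s, coeffMul u s (s⁻¹ * r) (a s) (b (s⁻¹ * r)))
    (summable_norm_conv a b)⟩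

lemma mul_apply (a b : UniversalAlgebra u) (r : G) :
    (a * b) r = ∑' s, coeffMul u s (s⁻¹ * r) (a s) (b (s⁻¹ * r)) := rfl

lemma norm_mul_le' (a b : UniversalAlgebra u) : ‖a * b‖ ≤ ‖a‖ * ‖b‖ := by
  rw [norm_eq, ← tsum_prod, (summable_prod a b).tsum_prod]
  exact (summable_norm_conv a b).tsum_le_tsum (norm_conv_le a b) (summable_prod a b).prod

/-- The product as a bounded bilinear map. -/
def mulBilin (u : Twist G X) :
    UniversalAlgebra u →L[ℂ] UniversalAlgebra u →L[ℂ] UniversalAlgebra u :=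
  LinearMap.mkContinuous₂
    (LinearMap.mk₂ ℂ (fun a b : UniversalAlgebra u => a * b)
      (fun a a' b => by
        ext1 r
        simp only [mul_apply, add_apply, coeffMul_add_left]
        exact (summable_coeff a b r).tsum_add (summable_coeff a' b r))
      (fun c a b => by
        ext1 r
        simp only [mul_apply, smul_apply, coeffMul_smul_left]
        exact (summable_coeff a b r).tsum_const_smul c)
      (fun a b b' => by
        ext1 r
        simp only [mul_apply, add_apply, coeffMul_add_right]
        exact (summable_coeff a b r).tsum_add (summable_coeff a b' r))
      (fun c a b => by
        ext1 r
        simp only [mul_apply, smul_apply, coeffMul_smul_right]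
        exact (summable_coeff a b r).tsum_const_smul c))
    1 (fun a b => by simpa using norm_mul_le' a b)

lemma mulBilin_apply (a b : UniversalAlgebra u) : mulBilin u a b = a * b := rfl

/-- The element `a δ_s`, as a bounded linear map of `a`. -/
def single (u : Twist G X) (s : G) : C₀(X, ℂ) →L[ℂ] UniversalAlgebra u := by
  classical
  exact (lp.singleContinuousLinearMap ℂ (fun _ : G => C₀(X, ℂ)) 1 s :
    C₀(X, ℂ) →L[ℂ] ↥(lp (fun _ : G => C₀(X, ℂ)) 1))

lemma single_apply_self (s : G) (a : C₀(X, ℂ)) : single u s a s = a := by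
  classical
  exact lp.single_apply_self (E := fun _ : G => C₀(X, ℂ)) 1 s a

lemma single_apply_ne {s r : G} (a : C₀(X, ℂ)) (h : r ≠ s) : single u s a r = 0 := by
  classical
  exact lp.single_apply_ne (E := fun _ : G => C₀(X, ℂ)) 1 s a h

lemma norm_single (s : G) (a : C₀(X, ℂ)) : ‖single u s a‖ = ‖a‖ := by
  classical
  exact lp.norm_single (E := fun _ : G => C₀(X, ℂ)) (p := 1) (by norm_num) s a

lemma hasSum_single (a : UniversalAlgebra u) : HasSum (fun s => single u s (a s)) a := by
  classical
  exact lp.hasSum_single (E := fun _ : G => C₀(X, ℂ)) (p := 1) (by norm_num)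
    (show ↥(lp (fun _ : G => C₀(X, ℂ)) 1) from a)

lemma hom_ext {E : Type*} [NormedAddCommGroup E] [NormedSpace ℂ E]
    {f g : UniversalAlgebra u →L[ℂ] E} (h : ∀ s a, f (single u s a) = g (single u s a)) :
    f = g := by
  ext a
  have ha := hasSum_single a
  rw [← (ha.map f f.continuous).tsum_eq, ← (ha.map g g.continuous).tsum_eq]
  simp [h]

lemma single_mul_single (s t : G) (a b : C₀(X, ℂ)) :
    single u s a * single u t b = single u (s * t) (coeffMul u s t a b) := by
  ext1 r
  rw [mul_apply, tsum_eq_single s]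
  · rw [single_apply_self]
    by_cases h : r = s * t
    · subst h
      simp [single_apply_self]
    · rw [single_apply_ne _ h, single_apply_ne b (r := s⁻¹ * r)]
      · ext x; simp
      · intro h'; exact h (by rw [← h']; simp)
  · intro s' hs'
    rw [single_apply_ne a hs']
    ext x; simp

lemma mul_assoc' (a b c : UniversalAlgebra u) : a * b * c = a * (b * c) := by
  let L₁ : UniversalAlgebra u →L[ℂ] UniversalAlgebra u →L[ℂ] UniversalAlgebra u →L[ℂ]
      UniversalAlgebra u :=
    ((ContinuousLinearMap.compL ℂ (UniversalAlgebra u) (UniversalAlgebra u)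
      (UniversalAlgebra u →L[ℂ] UniversalAlgebra u)) (mulBilin u)).comp (mulBilin u)
  let L₂ : UniversalAlgebra u →L[ℂ] UniversalAlgebra u →L[ℂ] UniversalAlgebra u →L[ℂ]
      UniversalAlgebra u :=
    ((ContinuousLinearMap.compL ℂ (UniversalAlgebra u) (UniversalAlgebra u →L[ℂ] UniversalAlgebra u)
      (UniversalAlgebra u →L[ℂ] UniversalAlgebra u)).flip (mulBilin u)).comp
      ((ContinuousLinearMap.compL ℂ (UniversalAlgebra u) (UniversalAlgebra u)
        (UniversalAlgebra u)).comp (mulBilin u))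
  have h₁ : ∀ a b c, L₁ a b c = a * b * c := fun _ _ _ => rfl
  have h₂ : ∀ a b c, L₂ a b c = a * (b * c) := fun _ _ _ => rfl
  rw [← h₁, ← h₂]
  have key : L₁ = L₂ := by
    refine hom_ext fun r a => hom_ext fun s b => hom_ext fun t c => ?_
    rw [h₁, h₂]
    simp only [single_mul_single, mul_assoc]
    congr 1
    ext x
    have hc := congrArg (fun z : Circle => (z : ℂ)) (u.cocycle r s t x)
    simp only [Circle.coe_mul] at hc
    simp only [coeffMul_apply, mul_inv_rev, mul_smul]
    linear_combination (- a x * b (r⁻¹ • x) * c (s⁻¹ • r⁻¹ • x)) * hc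
  rw [key]

end UniversalAlgebra

instance : NonUnitalNormedRing (UniversalAlgebra u) where
  left_distrib a b c := (UniversalAlgebra.mulBilin u a).map_add b c
  right_distrib a b c := by
    simp [← UniversalAlgebra.mulBilin_apply]
  zero_mul a := by simp [← UniversalAlgebra.mulBilin_apply]
  mul_zero a := (UniversalAlgebra.mulBilin u a).map_zero
  mul_assoc := UniversalAlgebra.mul_assoc'
  dist_eq a b := NormedAddCommGroup.dist_eq a b
  norm_mul_le := UniversalAlgebra.norm_mul_le'

instance : IsScalarTower ℂ (UniversalAlgebra u) (UniversalAlgebra u) :=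
  ⟨fun c a b => by simp [← UniversalAlgebra.mulBilin_apply]⟩

instance : SMulCommClass ℂ (UniversalAlgebra u) (UniversalAlgebra u) :=
  ⟨fun c a b => by simp [← UniversalAlgebra.mulBilin_apply]⟩

/-! ### Banach algebra completions of `F(α,u)` -/

/-- A submultiplicative seminorm on `F(α,u)` that is dominated by the `ℓ¹`-norm. -/
structure AlgSeminorm (u : Twist G X) extends Seminorm ℂ (UniversalAlgebra u) where
  mul_le' : ∀ a b, toFun (a * b) ≤ toFun a * toFun b
  le_norm' : ∀ a, toFun a ≤ ‖a‖

namespace AlgSeminorm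

instance : CoeFun (AlgSeminorm u) fun _ => UniversalAlgebra u → ℝ := ⟨fun N => N.toSeminorm⟩

lemma mul_le (N : AlgSeminorm u) (a b : UniversalAlgebra u) : N (a * b) ≤ N a * N b :=
  N.mul_le' a b

lemma le_norm (N : AlgSeminorm u) (a : UniversalAlgebra u) : N a ≤ ‖a‖ := N.le_norm' a

lemma nonneg (N : AlgSeminorm u) (a : UniversalAlgebra u) : 0 ≤ N a := apply_nonneg N.toSeminorm a

variable (u) in
/-- The norm of `F(α,u)` itself. -/
def universal : AlgSeminorm u where
  toSeminorm := normSeminorm ℂ (UniversalAlgebra u)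
  mul_le' a b := norm_mul_le a b
  le_norm' a := le_refl ‖a‖

lemma universal_apply (a : UniversalAlgebra u) : universal u a = ‖a‖ := rfl

lemma bddAbove (S : Set (AlgSeminorm u)) (a : UniversalAlgebra u) :
    BddAbove {r : ℝ | ∃ N ∈ S, r = N a} :=
  ⟨‖a‖, by rintro r ⟨N, -, rfl⟩; exact N.le_norm a⟩

lemma le_sup_aux (S : Set (AlgSeminorm u)) {N : AlgSeminorm u} (hN : N ∈ S)
    (a : UniversalAlgebra u) : N a ≤ sSup {r : ℝ | ∃ N ∈ S, r = N a} :=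
  le_csSup (bddAbove S a) ⟨N, hN, rfl⟩

lemma sup_nonneg_aux (S : Set (AlgSeminorm u)) (a : UniversalAlgebra u) :
    0 ≤ sSup {r : ℝ | ∃ N ∈ S, r = N a} :=
  Real.sSup_nonneg (by rintro r ⟨N, -, rfl⟩; exact N.nonneg a)

/-- The supremum `a ↦ sup_{N ∈ S} N(a)` of a set of such seminorms. -/
def sup (S : Set (AlgSeminorm u)) : AlgSeminorm u where
  toSeminorm := Seminorm.of (fun a => sSup {r : ℝ | ∃ N ∈ S, r = N a})
    (fun a b => by
      refine Real.sSup_le ?_ (add_nonneg (sup_nonneg_aux S a) (sup_nonneg_aux S b))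
      rintro r ⟨N, hN, rfl⟩
      exact (map_add_le_add N.toSeminorm a b).trans
        (add_le_add (le_sup_aux S hN a) (le_sup_aux S hN b)))
    (fun c a => by
      have h : {r : ℝ | ∃ N ∈ S, r = N (c • a)} = ‖c‖ • {r : ℝ | ∃ N ∈ S, r = N a} := by
        ext r
        simp only [Set.mem_ofPred_eq, Set.mem_smul_set, map_smul_eq_mul, smul_eq_mul]
        constructor
        · rintro ⟨N, hN, rfl⟩
          exact ⟨_, ⟨N, hN, rfl⟩, rfl⟩
        · rintro ⟨_, ⟨N, hN, rfl⟩, rfl⟩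
          exact ⟨N, hN, rfl⟩
      rw [h, Real.sSup_smul_of_nonneg (norm_nonneg c), smul_eq_mul])
  mul_le' a b := by
    refine Real.sSup_le ?_ (mul_nonneg (sup_nonneg_aux S a) (sup_nonneg_aux S b))
    rintro r ⟨N, hN, rfl⟩
    exact (N.mul_le a b).trans
      (mul_le_mul (le_sup_aux S hN a) (le_sup_aux S hN b) (N.nonneg b) (sup_nonneg_aux S a))
  le_norm' a := Real.sSup_le (by rintro r ⟨N, -, rfl⟩; exact N.le_norm a) (norm_nonneg a)

lemma sup_apply (S : Set (AlgSeminorm u)) (a : UniversalAlgebra u) :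
    sup S a = sSup {r : ℝ | ∃ N ∈ S, r = N a} := rfl

lemma le_sup {S : Set (AlgSeminorm u)} {N : AlgSeminorm u} (hN : N ∈ S)
    (a : UniversalAlgebra u) : N a ≤ sup S a := le_sup_aux S hN a

lemma sup_le {S : Set (AlgSeminorm u)} {a : UniversalAlgebra u} {C : ℝ} (hC : 0 ≤ C)
    (h : ∀ N ∈ S, N a ≤ C) : sup S a ≤ C :=
  Real.sSup_le (by rintro r ⟨N, hN, rfl⟩; exact h N hN) hC

end AlgSeminorm

/-- `F(α,u)`, equipped with the topology of the seminorm `N`. -/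
def SeminormedAlgebra (_N : AlgSeminorm u) : Type (max u v) := UniversalAlgebra u

variable (N : AlgSeminorm u)

instance : NonUnitalRing (SeminormedAlgebra N) :=
  inferInstanceAs (NonUnitalRing (UniversalAlgebra u))

instance : Module ℂ (SeminormedAlgebra N) := inferInstanceAs (Module ℂ (UniversalAlgebra u))

instance : IsScalarTower ℂ (SeminormedAlgebra N) (SeminormedAlgebra N) :=
  inferInstanceAs (IsScalarTower ℂ (UniversalAlgebra u) (UniversalAlgebra u))

instance : SMulCommClass ℂ (SeminormedAlgebra N) (SeminormedAlgebra N) :=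
  inferInstanceAs (SMulCommClass ℂ (UniversalAlgebra u) (UniversalAlgebra u))

instance : NonUnitalSeminormedRing (SeminormedAlgebra N) :=
  { (inferInstance : NonUnitalRing (SeminormedAlgebra N)),
    AddGroupSeminorm.toSeminormedAddCommGroup (E := SeminormedAlgebra N)
      (N.toSeminorm.toAddGroupSeminorm : AddGroupSeminorm (UniversalAlgebra u)) with
    norm_mul_le := N.mul_le }

lemma SeminormedAlgebra.norm_def (a : SeminormedAlgebra N) :
    ‖a‖ = N (show UniversalAlgebra u from a) := rfl

instance : NormedSpace ℂ (SeminormedAlgebra N) where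
  norm_smul_le c a := (map_smul_eq_mul N.toSeminorm c (show UniversalAlgebra u from a)).le

/-- The Banach algebra obtained from `F(α,u)` by Hausdorff completion in the seminorm `N`. -/
def BanachCompletion (N : AlgSeminorm u) : Type (max u v) := Completion (SeminormedAlgebra N)

namespace BanachCompletion

instance : NormedAddCommGroup (BanachCompletion N) :=
  inferInstanceAs (NormedAddCommGroup (Completion (SeminormedAlgebra N)))

instance : NormedSpace ℂ (BanachCompletion N) :=
  inferInstanceAs (NormedSpace ℂ (Completion (SeminormedAlgebra N)))

instance : CompleteSpace (BanachCompletion N) :=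
  inferInstanceAs (CompleteSpace (Completion (SeminormedAlgebra N)))

/-- The canonical map `F(α,u) → F_N(α,u)`. -/
def of : UniversalAlgebra u →L[ℂ] BanachCompletion N :=
  LinearMap.mkContinuous
    { toFun := fun a => ((show SeminormedAlgebra N from a : SeminormedAlgebra N) :
        Completion (SeminormedAlgebra N))
      map_add' := fun a b => Completion.coe_add (α := SeminormedAlgebra N) a b
      map_smul' := fun c a => Completion.coe_smul (X := SeminormedAlgebra N) c a } 1
    (fun a => by
      rw [one_mul]
      exact (Completion.norm_coe (E := SeminormedAlgebra N) a).le.trans (N.le_norm a))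

lemma norm_of (a : UniversalAlgebra u) : ‖of N a‖ = N a :=
  Completion.norm_coe (E := SeminormedAlgebra N) a

lemma denseRange_of : DenseRange (of N) := Completion.denseRange_coe (α := SeminormedAlgebra N)

variable {N} in
@[elab_as_elim]
lemma induction_on {p : BanachCompletion N → Prop} (x : BanachCompletion N)
    (hp : IsClosed {x | p x}) (h : ∀ a, p (of N a)) : p x :=
  Completion.induction_on (α := SeminormedAlgebra N) x hp h

/-- The continuous extension of the product. -/
instance : Mul (BanachCompletion N) :=
  ⟨Function.curry <| ((Completion.isDenseInducing_coe (α := SeminormedAlgebra N)).prodMap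
    (Completion.isDenseInducing_coe (α := SeminormedAlgebra N))).extend
      (fun q : SeminormedAlgebra N × SeminormedAlgebra N =>
        ((q.1 * q.2 : SeminormedAlgebra N) : Completion (SeminormedAlgebra N)))⟩

lemma of_mul (a b : UniversalAlgebra u) : of N (a * b) = of N a * of N b :=
  (((Completion.isDenseInducing_coe (α := SeminormedAlgebra N)).prodMap
    (Completion.isDenseInducing_coe (α := SeminormedAlgebra N))).extend_eq
      ((Completion.continuous_coe (SeminormedAlgebra N)).comp
        (continuous_mul (M := SeminormedAlgebra N))) (a, b)).symm

instance : ContinuousMul (BanachCompletion N) where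
  continuous_mul := by
    let m := (AddMonoidHom.mul : SeminormedAlgebra N →+ SeminormedAlgebra N →+ _).compr₂
      (Completion.toCompl (α := SeminormedAlgebra N))
    have hm : Continuous fun p : SeminormedAlgebra N × SeminormedAlgebra N => m p.1 p.2 :=
      (Completion.continuous_coe (SeminormedAlgebra N)).comp
        (continuous_mul (M := SeminormedAlgebra N))
    have di : IsDenseInducing (Completion.toCompl (α := SeminormedAlgebra N)) :=
      Completion.isDenseInducing_coe
    exact (di.extend_Z_bilin di hm :)

instance : NonUnitalNormedRing (BanachCompletion N) where
  zero_mul x := by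
    refine induction_on x ?_ fun a => ?_
    · exact isClosed_eq (by fun_prop) continuous_const
    rw [← (of N).map_zero, ← of_mul, zero_mul]
  mul_zero x := by
    refine induction_on x ?_ fun a => ?_
    · exact isClosed_eq (by fun_prop) continuous_const
    rw [← (of N).map_zero, ← of_mul, mul_zero]
  left_distrib x y z := by
    refine induction_on x ?_ fun a => ?_
    · exact isClosed_eq (by fun_prop) (by fun_prop)
    refine induction_on y ?_ fun b => ?_
    · exact isClosed_eq (by fun_prop) (by fun_prop)
    refine induction_on z ?_ fun c => ?_
    · exact isClosed_eq (by fun_prop) (by fun_prop)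
    rw [← of_mul, ← of_mul, ← (of N).map_add, ← (of N).map_add, ← of_mul, mul_add]
  right_distrib x y z := by
    refine induction_on x ?_ fun a => ?_
    · exact isClosed_eq (by fun_prop) (by fun_prop)
    refine induction_on y ?_ fun b => ?_
    · exact isClosed_eq (by fun_prop) (by fun_prop)
    refine induction_on z ?_ fun c => ?_
    · exact isClosed_eq (by fun_prop) (by fun_prop)
    rw [← of_mul, ← of_mul, ← (of N).map_add, ← (of N).map_add, ← of_mul, add_mul]
  mul_assoc x y z := by
    refine induction_on x ?_ fun a => ?_
    · exact isClosed_eq ((continuous_id.mul continuous_const).mul continuous_const)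
        (continuous_id.mul continuous_const)
    refine induction_on y ?_ fun b => ?_
    · exact isClosed_eq ((continuous_const.mul continuous_id).mul continuous_const)
        (continuous_const.mul (continuous_id.mul continuous_const))
    refine induction_on z ?_ fun c => ?_
    · exact isClosed_eq (continuous_const.mul continuous_id)
        (continuous_const.mul (continuous_const.mul continuous_id))
    rw [← of_mul, ← of_mul, ← of_mul, ← of_mul, mul_assoc]
  dist_eq x y := NormedAddCommGroup.dist_eq x y
  norm_mul_le x y := by
    refine induction_on x ?_ fun a => ?_
    · exact isClosed_le (continuous_id.mul continuous_const).norm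
        (continuous_id.norm.mul continuous_const)
    refine induction_on y ?_ fun b => ?_
    · exact isClosed_le (continuous_const.mul continuous_id).norm
        (continuous_const.mul continuous_id.norm)
    rw [← of_mul, norm_of, norm_of, norm_of]
    exact N.mul_le a b

instance : IsScalarTower ℂ (BanachCompletion N) (BanachCompletion N) := by
  refine ⟨fun c x y => ?_⟩
  simp only [smul_eq_mul]
  refine induction_on x ?_ fun a => ?_
  · exact isClosed_eq ((continuous_id.const_smul c).mul continuous_const)
      ((continuous_id.mul continuous_const).const_smul c)
  refine induction_on y ?_ fun b => ?_
  · exact isClosed_eq (continuous_const.mul continuous_id)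
      ((continuous_const.mul continuous_id).const_smul c)
  rw [← (of N).map_smul, ← of_mul, ← of_mul, ← (of N).map_smul, smul_mul_assoc]

instance : SMulCommClass ℂ (BanachCompletion N) (BanachCompletion N) := by
  refine ⟨fun c x y => ?_⟩
  simp only [smul_eq_mul]
  refine induction_on x ?_ fun a => ?_
  · exact isClosed_eq ((continuous_id.mul continuous_const).const_smul c)
      (continuous_id.mul continuous_const)
  refine induction_on y ?_ fun b => ?_
  · exact isClosed_eq ((continuous_const.mul continuous_id).const_smul c)
      (continuous_const.mul (continuous_id.const_smul c))
  rw [← (of N).map_smul, ← of_mul, ← of_mul, ← (of N).map_smul, mul_smul_comm]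

/-- The image of `C_0(X)` in `F_N(α,u)` under `a ↦ a δ_1`. -/
def coefficients : Submodule ℂ (BanachCompletion N) :=
  LinearMap.range ((of N).comp (UniversalAlgebra.single u 1)).toLinearMap

variable {N}

/-- For `N ≤ M`, the map `F(α,u) → F_N(α,u)`, as a bounded map for the seminorm `M`. -/
def ofLE {M : AlgSeminorm u} (h : ∀ a, N a ≤ M a) : SeminormedAlgebra M →L[ℂ] BanachCompletion N :=
  LinearMap.mkContinuous (𝕜 := ℂ) (σ := RingHom.id ℂ) (E := SeminormedAlgebra M)
    (F := BanachCompletion N)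
    { toFun := fun a => of N a
      map_add' := fun a b => (of N).map_add a b
      map_smul' := fun c a => (of N).map_smul c a } 1
    (fun a => by
      rw [one_mul]
      exact (norm_of N a).le.trans (h a))

variable (N) in
/-- The canonical map `F(α,u) → F_N(α,u)`, as an isometry for the seminorm `N`. -/
def coeL : SeminormedAlgebra N →L[ℂ] BanachCompletion N := ofLE (M := N) fun a => le_refl (N a)

variable (N) in
lemma isUniformInducing_coeL : IsUniformInducing (coeL N) :=
  have h : ∀ a : SeminormedAlgebra N, ‖coeL N a‖ = ‖a‖ := fun a => norm_of N a
  (AddMonoidHomClass.isometry_of_norm (coeL N) h).isUniformInducing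

variable (N) in
lemma denseRange_coeL : DenseRange (coeL N) := denseRange_of N

/-- For `N ≤ M`, the canonical homomorphism `F_M(α,u) → F_N(α,u)`, the continuous extension of the
identity of `F(α,u)`. -/
def canonicalMap {M : AlgSeminorm u} (h : ∀ a, N a ≤ M a) :
    BanachCompletion M →L[ℂ] BanachCompletion N :=
  (ofLE h).extend (coeL M)

lemma canonicalMap_of {M : AlgSeminorm u} (h : ∀ a, N a ≤ M a) (a : UniversalAlgebra u) :
    canonicalMap h (of M a) = of N a :=
  ContinuousLinearMap.extend_eq (ofLE h) (denseRange_coeL M) (isUniformInducing_coeL M) a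

lemma canonicalMap_mul {M : AlgSeminorm u} (h : ∀ a, N a ≤ M a) (x y : BanachCompletion M) :
    canonicalMap h (x * y) = canonicalMap h x * canonicalMap h y := by
  refine induction_on x ?_ fun a => ?_
  · exact isClosed_eq (by fun_prop) (by fun_prop)
  refine induction_on y ?_ fun b => ?_
  · exact isClosed_eq (by fun_prop) (by fun_prop)
  rw [← of_mul, canonicalMap_of, canonicalMap_of, canonicalMap_of, of_mul]

end BanachCompletion

/-! ### Representations and full crossed products -/

/-- A contractive homomorphism `F(α,u) → B(E)`. -/
structure Representation (u : Twist G X) (E : Type*) [NormedAddCommGroup E] [NormedSpace ℂ E] where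
  toCLM : UniversalAlgebra u →L[ℂ] (E →L[ℂ] E)
  map_mul' : ∀ a b, toCLM (a * b) = (toCLM a).comp (toCLM b)
  norm_le' : ∀ a, ‖toCLM a‖ ≤ ‖a‖

namespace Representation

variable {E : Type*} [NormedAddCommGroup E] [NormedSpace ℂ E]

/-- A representation is non-degenerate if the vectors `ψ(b) ξ` span a dense subspace. -/
def IsNondegenerate (ψ : Representation u E) : Prop :=
  (Submodule.span ℂ {y : E | ∃ b ξ, y = ψ.toCLM b ξ}).topologicalClosure = ⊤

/-- The seminorm `b ↦ ‖ψ(b)‖`. -/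
def seminorm (ψ : Representation u E) : AlgSeminorm u where
  toSeminorm := (normSeminorm ℂ (E →L[ℂ] E)).comp ψ.toCLM.toLinearMap
  mul_le' a b := by
    change ‖ψ.toCLM (a * b)‖ ≤ ‖ψ.toCLM a‖ * ‖ψ.toCLM b‖
    rw [ψ.map_mul']
    exact ContinuousLinearMap.opNorm_comp_le _ _
  le_norm' := ψ.norm_le'

lemma seminorm_apply (ψ : Representation u E) (b : UniversalAlgebra u) :
    ψ.seminorm b = ‖ψ.toCLM b‖ := rfl

end Representation

/-- The set of Hölder exponents `[1,∞]`. -/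
abbrev Exponent : Type := Set.Ici (1 : ℝ≥0∞)

instance (p : Exponent) : Fact (1 ≤ (p : ℝ≥0∞)) := ⟨p.2⟩

/-- `E` is isometrically isomorphic to `L^p(μ)` for some measure space `(Ω, μ)`. -/
def IsLpSpace (p : Exponent) (E : Type w) [NormedAddCommGroup E] [NormedSpace ℂ E] : Prop :=
  ∃ (Ω : Type w) (_ : MeasurableSpace Ω) (μ : Measure Ω),
    Nonempty (E ≃ₗᵢ[ℂ] Lp ℂ (p : ℝ≥0∞) μ)

/-- `E` is isometrically isomorphic to `C_0(Ω)` for some topological space `Ω`. -/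
def IsC0Space (E : Type w) [NormedAddCommGroup E] [NormedSpace ℂ E] : Prop :=
  ∃ (Ω : Type w) (_ : TopologicalSpace Ω), Nonempty (E ≃ₗᵢ[ℂ] C₀(Ω, ℂ))

/-- The spaces used for the exponent `p`: `L^p`-spaces if `p < ∞`, and `C_0`-spaces if `p = ∞`. -/
def IsModelSpace (p : Exponent) (E : Type w) [NormedAddCommGroup E] [NormedSpace ℂ E] : Prop :=
  ((p : ℝ≥0∞) ≠ ∞ ∧ IsLpSpace p E) ∨ ((p : ℝ≥0∞) = ∞ ∧ IsC0Space E)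

/-- The norm `‖·‖_{L^p}` of `F^p(α,u)`: the supremum of `‖ψ(b)‖` over all non-degenerate
representations `ψ` on `L^p`-spaces (on `C_0`-spaces if `p = ∞`). -/
def fullSeminorm (u : Twist G X) (p : Exponent) : AlgSeminorm u :=
  AlgSeminorm.sup {N | ∃ (E : Type (max u v)) (_ : NormedAddCommGroup E) (_ : NormedSpace ℂ E)
    (ψ : Representation u E), IsModelSpace p E ∧ ψ.IsNondegenerate ∧ N = ψ.seminorm}

/-! ### The regular representation and reduced crossed products -/

section RegularSpace

variable (I : Type w) (p : Exponent)

/-- The space `{ξ ∈ ℓ^p(I) : ξ vanishes at infinity}`, where `I` is discrete. This is `ℓ^p(I)` if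
`p < ∞`, and `c_0(I)` if `p = ∞`. -/
def regularSpace : Submodule ℂ ↥(lp (fun _ : I => ℂ) (p : ℝ≥0∞)) where
  carrier := {ξ | Tendsto (fun i => ξ i) cofinite (𝓝 0)}
  zero_mem' := by
    change Tendsto (fun _ : I => (0 : ℂ)) cofinite (𝓝 0)
    exact tendsto_const_nhds
  add_mem' {ξ η} hξ hη := by
    have h := (show Tendsto (fun i => ξ i) cofinite (𝓝 0) from hξ).add
      (show Tendsto (fun i => η i) cofinite (𝓝 0) from hη)
    rw [add_zero] at h
    exact h
  smul_mem' c ξ hξ := by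
    have h := (show Tendsto (fun i => ξ i) cofinite (𝓝 0) from hξ).const_smul c
    rw [smul_zero] at h
    exact h

variable {I p}

lemma exponent_ne_zero : (p : ℝ≥0∞) ≠ 0 := (zero_lt_one.trans_le p.2).ne'

lemma exponent_toReal_pos (hp : (p : ℝ≥0∞) ≠ ∞) : 0 < (p : ℝ≥0∞).toReal :=
  ENNReal.toReal_pos exponent_ne_zero hp

lemma regularSpace_eq_top (hp : (p : ℝ≥0∞) ≠ ∞) : regularSpace I p = ⊤ := by
  refine eq_top_iff.2 fun ξ _ => ?_
  have hp' := exponent_toReal_pos hp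
  have h := ((lp.memℓp ξ).summable hp').tendsto_cofinite_zero
  change Tendsto (fun i => ξ i) cofinite (𝓝 0)
  rw [tendsto_zero_iff_norm_tendsto_zero]
  have h2 := h.rpow_const (p := (p : ℝ≥0∞).toReal⁻¹) (Or.inr (inv_nonneg.2 hp'.le))
  rw [Real.zero_rpow (inv_ne_zero hp'.ne')] at h2
  refine h2.congr fun i => ?_
  rw [← Real.rpow_mul (norm_nonneg _), mul_inv_cancel₀ hp'.ne', Real.rpow_one]

lemma isClosed_regularSpace :
    IsClosed (regularSpace I p : Set ↥(lp (fun _ : I => ℂ) (p : ℝ≥0∞))) := by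
  refine isClosed_of_closure_subset fun ξ hξ => ?_
  change Tendsto (fun i => ξ i) cofinite (𝓝 0)
  rw [Metric.tendsto_nhds]
  intro ε hε
  obtain ⟨η, hη, hd⟩ := Metric.mem_closure_iff.1 hξ (ε / 2) (half_pos hε)
  have h2 := (Metric.tendsto_nhds.1 (show Tendsto (fun i => η i) cofinite (𝓝 0) from hη)) (ε / 2)
    (half_pos hε)
  refine h2.mono fun i hi => ?_
  have h3 := lp.norm_apply_le_norm exponent_ne_zero (ξ - η) i
  rw [← dist_eq_norm] at h3
  have h4 : dist (ξ i) (η i) ≤ dist ξ η := by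
    rw [dist_eq_norm (ξ i)]
    exact h3
  calc dist (ξ i) 0 ≤ dist (ξ i) (η i) + dist (η i) 0 := dist_triangle _ _ _
    _ < ε := by linarith

variable (I p) in
/-- The Banach space `ℓ^p(I)` (`c_0(I)` if `p = ∞`). -/
def RegularSpace : Type w := ↥(regularSpace I p)

instance : NormedAddCommGroup (RegularSpace I p) :=
  inferInstanceAs (NormedAddCommGroup ↥(regularSpace I p))

instance : NormedSpace ℂ (RegularSpace I p) :=
  inferInstanceAs (NormedSpace ℂ ↥(regularSpace I p))

instance : CompleteSpace (RegularSpace I p) := isClosed_regularSpace.completeSpace_coe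

namespace RegularSpace

/-- The underlying element of `ℓ^p(I)`. -/
def toLp (ξ : RegularSpace I p) : ↥(lp (fun _ : I => ℂ) (p : ℝ≥0∞)) := Subtype.val ξ

instance : CoeFun (RegularSpace I p) fun _ => I → ℂ := ⟨fun ξ => ξ.toLp⟩

lemma norm_toLp (ξ : RegularSpace I p) : ‖ξ.toLp‖ = ‖ξ‖ := rfl

lemma tendsto (ξ : RegularSpace I p) : Tendsto (fun i => ξ i) cofinite (𝓝 0) := Subtype.property ξ

lemma memℓp (ξ : RegularSpace I p) : Memℓp (fun i => ξ i) (p : ℝ≥0∞) := lp.memℓp ξ.toLp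

/-- A function in `ℓ^p(I)` that vanishes at infinity, as an element of `RegularSpace I p`. -/
def mk (f : I → ℂ) (hf : Memℓp f (p : ℝ≥0∞)) (hf' : Tendsto f cofinite (𝓝 0)) :
    RegularSpace I p := ⟨⟨f, hf⟩, hf'⟩

@[simp] lemma mk_apply (f : I → ℂ) (hf : Memℓp f (p : ℝ≥0∞)) (hf' : Tendsto f cofinite (𝓝 0))
    (i : I) : (mk f hf hf' : RegularSpace I p) i = f i := rfl

@[simp] lemma add_apply (ξ η : RegularSpace I p) (i : I) : (ξ + η) i = ξ i + η i := rfl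

@[simp] lemma smul_apply (c : ℂ) (ξ : RegularSpace I p) (i : I) : (c • ξ) i = c * ξ i := rfl

@[ext] lemma ext {ξ η : RegularSpace I p} (h : ∀ i, ξ i = η i) : ξ = η :=
  Subtype.ext <| lp.ext <| funext h

lemma norm_apply_le (ξ : RegularSpace I p) (i : I) : ‖ξ i‖ ≤ ‖ξ‖ :=
  lp.norm_apply_le_norm exponent_ne_zero ξ.toLp i

end RegularSpace

lemma memℓp_comp_equiv (e : I ≃ I) {f : I → ℂ} (hf : Memℓp f (p : ℝ≥0∞)) :
    Memℓp (f ∘ e) (p : ℝ≥0∞) := by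
  by_cases hp : (p : ℝ≥0∞) = ∞
  · rw [hp, memℓp_infty_iff] at hf ⊢
    exact hf.mono (by rintro _ ⟨i, rfl⟩; exact ⟨e i, rfl⟩)
  · have hp' := exponent_toReal_pos hp
    rw [memℓp_gen_iff hp'] at hf ⊢
    exact (e.summable_iff (f := fun i => ‖f i‖ ^ (p : ℝ≥0∞).toReal)).2 hf

lemma norm_comp_equiv_le (e : I ≃ I) (ξ : ↥(lp (fun _ : I => ℂ) (p : ℝ≥0∞)))
    {η : ↥(lp (fun _ : I => ℂ) (p : ℝ≥0∞))} (h : ∀ i, η i = ξ (e i)) : ‖η‖ ≤ ‖ξ‖ := by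
  by_cases hp : (p : ℝ≥0∞) = ∞
  · obtain ⟨p, hp1⟩ := p
    subst hp
    exact lp.norm_le_of_forall_le (norm_nonneg _) fun i => by
      rw [h]; exact lp.norm_apply_le_norm (by simp) ξ _
  · have hp' := exponent_toReal_pos hp
    refine lp.norm_le_of_tsum_le hp' (norm_nonneg _) ?_
    rw [lp.norm_rpow_eq_tsum hp']
    simp_rw [h]
    exact (e.tsum_eq (fun i => ‖ξ i‖ ^ (p : ℝ≥0∞).toReal)).le

/-- The weighted composition operator `ξ ↦ w · (ξ ∘ e)`, for a bounded weight `w` and a permutation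
`e` of `I`. -/
def weightedComp (w : I → ℂ) (C : ℝ) (hC : 0 ≤ C) (hw : ∀ i, ‖w i‖ ≤ C) (e : I ≃ I) :
    RegularSpace I p →L[ℂ] RegularSpace I p :=
  have hmem : ∀ ξ : RegularSpace I p, Memℓp (fun i => w i * ξ (e i)) (p : ℝ≥0∞) := fun ξ =>
    ((memℓp_comp_equiv e ξ.memℓp).const_smul (C : ℂ)).mono' fun i => by
      simpa [abs_of_nonneg hC] using mul_le_mul_of_nonneg_right (hw i) (norm_nonneg (ξ (e i)))
  have htends : ∀ ξ : RegularSpace I p, Tendsto (fun i => w i * ξ (e i)) cofinite (𝓝 0) :=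
    fun ξ => by
      have h2 := (ξ.tendsto.comp e.injective.tendsto_cofinite).norm.const_mul C
      rw [norm_zero, mul_zero] at h2
      refine squeeze_zero_norm (fun i => ?_) h2
      rw [norm_mul]
      exact mul_le_mul_of_nonneg_right (hw i) (norm_nonneg _)
  LinearMap.mkContinuous
    { toFun := fun ξ => RegularSpace.mk (fun i => w i * ξ (e i)) (hmem ξ) (htends ξ)
      map_add' := fun ξ η => RegularSpace.ext fun i => mul_add (w i) _ _
      map_smul' := fun c ξ => RegularSpace.ext fun i => mul_left_comm (w i) c _ }
    C (fun ξ => by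
      let η : ↥(lp (fun _ : I => ℂ) (p : ℝ≥0∞)) :=
        ⟨fun i => ξ (e i), memℓp_comp_equiv e ξ.memℓp⟩
      have h1 : ‖η‖ ≤ ‖ξ.toLp‖ := norm_comp_equiv_le e ξ.toLp fun _ => rfl
      have h2 : ‖(⟨fun i => w i * ξ (e i), hmem ξ⟩ : ↥(lp (fun _ : I => ℂ) (p : ℝ≥0∞)))‖
          ≤ ‖(C : ℂ) • η‖ := lp.norm_mono exponent_ne_zero fun i => by
        change ‖w i * ξ (e i)‖ ≤ ‖(C : ℂ) * ξ (e i)‖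
        rw [norm_mul, norm_mul, Complex.norm_real, Real.norm_of_nonneg hC]
        exact mul_le_mul_of_nonneg_right (hw i) (norm_nonneg _)
      rw [norm_smul, Complex.norm_real, Real.norm_of_nonneg hC] at h2
      exact h2.trans (mul_le_mul_of_nonneg_left h1 hC))

@[simp] lemma weightedComp_apply (w : I → ℂ) (C : ℝ) (hC : 0 ≤ C) (hw : ∀ i, ‖w i‖ ≤ C)
    (e : I ≃ I) (ξ : RegularSpace I p) (i : I) : weightedComp w C hC hw e ξ i = w i * ξ (e i) := rfl

lemma norm_weightedComp_le (w : I → ℂ) (C : ℝ) (hC : 0 ≤ C) (hw : ∀ i, ‖w i‖ ≤ C) (e : I ≃ I) :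
    ‖(weightedComp w C hC hw e : RegularSpace I p →L[ℂ] RegularSpace I p)‖ ≤ C := by
  unfold weightedComp
  exact LinearMap.mkContinuous_norm_le _ hC _

/-- Evaluation at a point of `I`. -/
def evalCLM (i : I) : RegularSpace I p →L[ℂ] ℂ :=
  LinearMap.mkContinuous
    { toFun := fun ξ => ξ i
      map_add' := fun _ _ => rfl
      map_smul' := fun _ _ => rfl } 1
    (fun ξ => by rw [one_mul]; exact ξ.norm_apply_le i)

lemma evalCLM_apply (i : I) (ξ : RegularSpace I p) : evalCLM i ξ = ξ i := rfl

end RegularSpace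

section RegularRepresentation

variable (p : Exponent)

/-- The permutation `(x,t) ↦ (s⁻¹ • x, s⁻¹ t)` of `X × G`. -/
def shiftEquiv (X : Type u) [MulAction G X] (s : G) : X × G ≃ X × G where
  toFun q := (s⁻¹ • q.1, s⁻¹ * q.2)
  invFun q := (s • q.1, s * q.2)
  left_inv q := by simp
  right_inv q := by simp

variable (u) in
/-- The operator `π(a) v_s`, that is
`ξ ↦ ((x,t) ↦ a(x) u(s, s⁻¹ t)(x) ξ(s⁻¹ • x, s⁻¹ t))`. -/
def regularOp (s : G) (a : C₀(X, ℂ)) : RegularSpace (X × G) p →L[ℂ] RegularSpace (X × G) p :=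
  weightedComp (fun q => a q.1 * (u.toFun s (s⁻¹ * q.2) q.1 : ℂ)) ‖a‖ (norm_nonneg a)
    (fun q => by rw [norm_mul, Circle.norm_coe, mul_one]; exact norm_apply_le a q.1)
    (shiftEquiv X s)

lemma regularOp_apply (s : G) (a : C₀(X, ℂ)) (ξ : RegularSpace (X × G) p) (x : X) (t : G) :
    regularOp u p s a ξ (x, t) =
      a x * (u.toFun s (s⁻¹ * t) x : ℂ) * ξ (s⁻¹ • x, s⁻¹ * t) := rfl

lemma norm_regularOp_le (s : G) (a : C₀(X, ℂ)) : ‖regularOp u p s a‖ ≤ ‖a‖ :=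
  norm_weightedComp_le _ _ _ _ _

lemma summable_regularOp (b : UniversalAlgebra u) : Summable fun s => regularOp u p s (b s) :=
  Summable.of_norm_bounded b.summable_norm fun s => norm_regularOp_le p s (b s)

lemma regularOp_add (s : G) (a b : C₀(X, ℂ)) :
    regularOp u p s (a + b) = regularOp u p s a + regularOp u p s b := by
  ext1 ξ
  refine RegularSpace.ext fun q => ?_
  change (a q.1 + b q.1) * _ * _ = a q.1 * _ * _ + b q.1 * _ * _
  ring

lemma regularOp_smul (s : G) (c : ℂ) (a : C₀(X, ℂ)) :
    regularOp u p s (c • a) = c • regularOp u p s a := by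
  ext1 ξ
  refine RegularSpace.ext fun q => ?_
  change (c * a q.1) * _ * _ = c * (a q.1 * _ * _)
  ring

lemma regularOp_comp (s t : G) (a b : C₀(X, ℂ)) :
    (regularOp u p s a).comp (regularOp u p t b) = regularOp u p (s * t) (coeffMul u s t a b) := by
  ext1 ξ
  refine RegularSpace.ext fun q => ?_
  obtain ⟨x, r⟩ := q
  rw [ContinuousLinearMap.comp_apply, regularOp_apply, regularOp_apply, regularOp_apply,
    coeffMul_apply]
  have hc := congrArg (fun z : Circle => (z : ℂ)) (u.cocycle s t (t⁻¹ * (s⁻¹ * r)) x)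
  simp only [Circle.coe_mul, mul_inv_cancel_left] at hc
  simp only [mul_inv_rev, mul_smul, mul_assoc t⁻¹]
  linear_combination (a x * b (s⁻¹ • x) * ξ (t⁻¹ • s⁻¹ • x, t⁻¹ * (s⁻¹ * r))) * hc

lemma norm_tsum_regularOp_le (b : UniversalAlgebra u) :
    ‖∑' s, regularOp u p s (b s)‖ ≤ ‖b‖ := by
  rw [UniversalAlgebra.norm_eq]
  exact tsum_of_norm_bounded b.summable_norm.hasSum fun s => norm_regularOp_le p s (b s)

variable (u) in
/-- The bounded linear map `b ↦ Λ_p(b) = ∑_s π(b(s)) v_s`. -/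
def regularCLM : UniversalAlgebra u →L[ℂ]
    (RegularSpace (X × G) p →L[ℂ] RegularSpace (X × G) p) :=
  LinearMap.mkContinuous
    { toFun := fun b => ∑' s, regularOp u p s (b s)
      map_add' := fun a b => by
        rw [← (summable_regularOp p a).tsum_add (summable_regularOp p b)]
        exact tsum_congr fun s => regularOp_add p s _ _
      map_smul' := fun c b => by
        rw [RingHom.id_apply, ← (summable_regularOp p b).tsum_const_smul c]
        exact tsum_congr fun s => regularOp_smul p s c _ } 1
    (fun b => by
      rw [one_mul]
      exact norm_tsum_regularOp_le p b)

lemma regularCLM_apply (b : UniversalAlgebra u) :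
    regularCLM u p b = ∑' s, regularOp u p s (b s) := rfl

lemma norm_regularCLM_apply_le (b : UniversalAlgebra u) : ‖regularCLM u p b‖ ≤ ‖b‖ :=
  norm_tsum_regularOp_le p b

lemma regularCLM_single (s : G) (a : C₀(X, ℂ)) :
    regularCLM u p (UniversalAlgebra.single u s a) = regularOp u p s a := by
  rw [regularCLM_apply, tsum_eq_single s, UniversalAlgebra.single_apply_self]
  intro r hr
  rw [UniversalAlgebra.single_apply_ne a hr]
  ext1 ξ
  refine RegularSpace.ext fun q => ?_
  change (0 : ℂ) * _ * _ = 0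
  ring

variable (u) in
/-- The regular representation `Λ_p` of `F(α,u)` on `ℓ^p(X × G)` (on `c_0(X × G)` if `p = ∞`). -/
def regularRep : Representation u (RegularSpace (X × G) p) where
  toCLM := regularCLM u p
  map_mul' a b := by
    let L₁ : UniversalAlgebra u →L[ℂ] UniversalAlgebra u →L[ℂ]
        (RegularSpace (X × G) p →L[ℂ] RegularSpace (X × G) p) :=
      ((ContinuousLinearMap.compL ℂ (UniversalAlgebra u) (UniversalAlgebra u)
        (RegularSpace (X × G) p →L[ℂ] RegularSpace (X × G) p)) (regularCLM u p)).comp (UniversalAlgebra.mulBilin u)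
    let L₂ : UniversalAlgebra u →L[ℂ] UniversalAlgebra u →L[ℂ]
        (RegularSpace (X × G) p →L[ℂ] RegularSpace (X × G) p) :=
      (ContinuousLinearMap.compL ℂ (RegularSpace (X × G) p) (RegularSpace (X × G) p)
        (RegularSpace (X × G) p)).bilinearComp (regularCLM u p) (regularCLM u p)
    have h₁ : ∀ a b, L₁ a b = regularCLM u p (a * b) := fun _ _ => rfl
    have h₂ : ∀ a b, L₂ a b = (regularCLM u p a).comp (regularCLM u p b) := fun _ _ => rfl
    have key : L₁ = L₂ := by
      refine UniversalAlgebra.hom_ext fun s a => UniversalAlgebra.hom_ext fun t b => ?_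
      rw [h₁, h₂, UniversalAlgebra.single_mul_single, regularCLM_single, regularCLM_single,
        regularCLM_single, regularOp_comp]
    rw [← h₁, ← h₂, key]
  norm_le' := norm_regularCLM_apply_le p

/-- The explicit formula for the regular representation:
`Λ_p(b)ξ(x,t) = ∑_s b(s)(x) u(s, s⁻¹ t)(x) ξ(s⁻¹ • x, s⁻¹ t)`. -/
lemma regularRep_apply (b : UniversalAlgebra u) (ξ : RegularSpace (X × G) p) (x : X) (t : G) :
    (regularRep u p).toCLM b ξ (x, t) =
      ∑' s, b s x * (u.toFun s (s⁻¹ * t) x : ℂ) * ξ (s⁻¹ • x, s⁻¹ * t) := by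
  have h := (summable_regularOp p b).hasSum.mapL
    ((evalCLM (p := p) (x, t)).comp (ContinuousLinearMap.apply ℂ (RegularSpace (X × G) p) ξ))
  exact h.tsum_eq.symm

/-- The norm `‖·‖_{L^p,r}` of `F^p_r(α,u)`. -/
def reducedSeminorm (u : Twist G X) (p : Exponent) : AlgSeminorm u := (regularRep u p).seminorm

end RegularRepresentation

/-! The regular representation belongs to the class defining the full crossed product. -/

section RegularIsModel

variable {I : Type w} {p : Exponent}

lemma eLpNorm_count_eq [MeasurableSpace I] [MeasurableSingletonClass I] (hp : (p : ℝ≥0∞) ≠ ∞) (f : I → ℂ) :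
    eLpNorm f (p : ℝ≥0∞) Measure.count =
      (∑' i, ‖f i‖ₑ ^ (p : ℝ≥0∞).toReal) ^ (1 / (p : ℝ≥0∞).toReal) := by
  rw [eLpNorm_eq_lintegral_rpow_enorm_toReal exponent_ne_zero hp, lintegral_count]

lemma tsum_enorm_rpow (hp : (p : ℝ≥0∞) ≠ ∞) (ξ : RegularSpace I p) :
    ∑' i, ‖ξ i‖ₑ ^ (p : ℝ≥0∞).toReal = ENNReal.ofReal (‖ξ‖ ^ (p : ℝ≥0∞).toReal) := by
  have hp' := exponent_toReal_pos hp
  rw [← ξ.norm_toLp, lp.norm_rpow_eq_tsum hp',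
    ENNReal.ofReal_tsum_of_nonneg (fun _ => by positivity) (ξ.memℓp.summable hp')]
  refine tsum_congr fun i => ?_
  rw [← ENNReal.ofReal_rpow_of_nonneg (norm_nonneg _) hp'.le, ofReal_norm]

lemma eLpNorm_regularSpace [MeasurableSpace I] [MeasurableSingletonClass I]
    (hp : (p : ℝ≥0∞) ≠ ∞) (ξ : RegularSpace I p) :
    eLpNorm (fun i => ξ i) (p : ℝ≥0∞) Measure.count = ENNReal.ofReal ‖ξ‖ := by
  have hp' := exponent_toReal_pos hp
  rw [eLpNorm_count_eq hp, tsum_enorm_rpow hp, ENNReal.ofReal_rpow_of_nonneg (by positivity)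
    (by positivity), ← Real.rpow_mul (norm_nonneg _), mul_one_div_cancel hp'.ne', Real.rpow_one]

lemma isLpSpace_regularSpace (hp : (p : ℝ≥0∞) ≠ ∞) : IsLpSpace p (RegularSpace I p) := by
  let _ : MeasurableSpace I := ⊤
  have hp' := exponent_toReal_pos hp
  have hm : ∀ ξ : RegularSpace I p, MemLp (fun i => ξ i) (p : ℝ≥0∞) (Measure.count : Measure I) :=
    fun ξ => ⟨(measurable_from_top (f := fun i => ξ i)).aestronglyMeasurable, by
      rw [eLpNorm_regularSpace hp]; exact ENNReal.ofReal_lt_top⟩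
  let L : RegularSpace I p →ₗᵢ[ℂ] Lp ℂ (p : ℝ≥0∞) (Measure.count : Measure I) :=
    { toFun := fun ξ => (hm ξ).toLp
      map_add' := fun ξ η => MemLp.toLp_add (hm ξ) (hm η)
      map_smul' := fun c ξ => MemLp.toLp_const_smul c (hm ξ)
      norm_map' := fun ξ => by
        change ‖(hm ξ).toLp‖ = ‖ξ‖
        rw [Lp.norm_toLp, eLpNorm_regularSpace hp, ENNReal.toReal_ofReal (norm_nonneg _)] }
  refine ⟨I, ⊤, Measure.count, ⟨LinearIsometryEquiv.ofSurjective L fun g => ?_⟩⟩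
  have hg : Memℓp (fun i => g i) (p : ℝ≥0∞) := by
    have h := (Lp.memLp g).eLpNorm_lt_top
    rw [eLpNorm_count_eq hp] at h
    have h2 : ∑' i, ‖g i‖ₑ ^ (p : ℝ≥0∞).toReal ≠ ∞ := by
      intro h3
      rw [h3, ENNReal.top_rpow_of_pos (by positivity)] at h
      exact lt_irrefl _ h
    refine memℓp_gen ?_
    have h3 := ENNReal.summable_toReal h2
    refine h3.congr fun i => ?_
    rw [← ENNReal.toReal_rpow, toReal_enorm]
  let ξ₀ : ↥(lp (fun _ : I => ℂ) (p : ℝ≥0∞)) := ⟨fun i => g i, hg⟩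
  have hξ₀ : ξ₀ ∈ regularSpace I p := by rw [regularSpace_eq_top hp]; trivial
  let ξ : RegularSpace I p := RegularSpace.mk (fun i => g i) hg hξ₀
  refine ⟨ξ, Lp.ext ?_⟩
  exact (hm ξ).coeFn_toLp

lemma isC0Space_regularSpace (hp : (p : ℝ≥0∞) = ∞) : IsC0Space (RegularSpace I p) := by
  let _ : TopologicalSpace I := ⊥
  have _ : DiscreteTopology I := ⟨rfl⟩
  have hcc : cocompact I = cofinite := cocompact_eq_cofinite I
  let F : RegularSpace I p → C₀(I, ℂ) := fun ξ =>
    { toFun := fun i => ξ i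
      continuous_toFun := continuous_of_discreteTopology
      zero_at_infty' := by rw [hcc]; exact ξ.tendsto }
  let L : RegularSpace I p →ₗᵢ[ℂ] C₀(I, ℂ) :=
    { toFun := F
      map_add' := fun ξ η => rfl
      map_smul' := fun c ξ => rfl
      norm_map' := fun ξ => by
        change ‖F ξ‖ = ‖ξ‖
        refine le_antisymm (norm_le_of_apply (norm_nonneg _) fun i => ξ.norm_apply_le i) ?_
        obtain ⟨p, hp1⟩ := p
        subst hp
        exact lp.norm_le_of_forall_le (f := ξ.toLp) (norm_nonneg _) fun i => norm_apply_le (F ξ) i }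
  refine ⟨I, ⊥, ⟨LinearIsometryEquiv.ofSurjective L fun g => ?_⟩⟩
  have hg : Memℓp (fun i => g i) (p : ℝ≥0∞) := by
    rw [hp]
    exact memℓp_infty ⟨‖g‖, by rintro _ ⟨i, rfl⟩; exact norm_apply_le g i⟩
  refine ⟨RegularSpace.mk (fun i => g i) hg ?_, rfl⟩
  rw [← hcc]
  exact zero_at_infty g

lemma isModelSpace_regularSpace : IsModelSpace p (RegularSpace I p) := by
  by_cases hp : (p : ℝ≥0∞) = ∞
  · exact Or.inr ⟨hp, isC0Space_regularSpace hp⟩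
  · exact Or.inl ⟨hp, isLpSpace_regularSpace hp⟩

open Classical in
variable (p) in
/-- The canonical basis vector at `i`. -/
def basisVec (i : I) : RegularSpace I p :=
  RegularSpace.mk (lp.single (E := fun _ : I => ℂ) (p : ℝ≥0∞) i 1)
    (lp.memℓp (lp.single (E := fun _ : I => ℂ) (p : ℝ≥0∞) i 1))
    (by
      refine tendsto_const_nhds.congr' ?_
      have h : ∀ᶠ j : I in cofinite, j ≠ i := (Set.finite_singleton i).compl_mem_cofinite
      filter_upwards [h] with j hj
      exact (lp.single_apply_ne (E := fun _ : I => ℂ) (p : ℝ≥0∞) i 1 hj).symm)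

lemma basisVec_self (i : I) : basisVec p i i = 1 := by
  classical
  exact lp.single_apply_self (E := fun _ : I => ℂ) (p : ℝ≥0∞) i 1

lemma basisVec_ne {i j : I} (h : j ≠ i) : basisVec p i j = 0 := by
  classical
  exact lp.single_apply_ne (E := fun _ : I => ℂ) (p : ℝ≥0∞) i 1 h

lemma toLp_sum (s : Finset I) (f : I → RegularSpace I p) :
    (∑ i ∈ s, f i).toLp = ∑ i ∈ s, (f i).toLp :=
  map_sum (regularSpace I p).subtype.toAddMonoidHom f s

lemma sum_basisVec_apply (ξ : RegularSpace I p) (s : Finset I) (j : I) [Decidable (j ∈ s)] :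
    (∑ i ∈ s, ξ i • basisVec p i : RegularSpace I p) j = if j ∈ s then ξ j else 0 := by
  rw [← evalCLM_apply, map_sum]
  simp only [evalCLM_apply, RegularSpace.smul_apply]
  split_ifs with h
  · rw [Finset.sum_eq_single_of_mem j h]
    · rw [basisVec_self, mul_one]
    · intro i _ hi
      rw [basisVec_ne hi.symm, mul_zero]
  · refine Finset.sum_eq_zero fun i hi => ?_
    rw [basisVec_ne (show j ≠ i from fun hji => h (hji ▸ hi)), mul_zero]

lemma hasSum_basisVec (ξ : RegularSpace I p) : HasSum (fun i => ξ i • basisVec p i) ξ := by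
  classical
  by_cases hp : (p : ℝ≥0∞) = ∞
  · rw [HasSum, SummationFilter.unconditional_filter, Metric.tendsto_atTop]
    intro ε hε
    have hfin := Metric.tendsto_nhds.1 ξ.tendsto (ε / 2) (half_pos hε)
    rw [Filter.Eventually, mem_cofinite] at hfin
    refine ⟨hfin.toFinset, fun s hs => ?_⟩
    rw [dist_eq_norm]
    refine lt_of_le_of_lt ?_ (half_lt_self hε)
    have key : ∀ j, ‖(∑ i ∈ s, ξ i • basisVec p i - ξ : RegularSpace I p) j‖ ≤ ε / 2 := by
      intro j
      have h : (∑ i ∈ s, ξ i • basisVec p i - ξ : RegularSpace I p) j =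
          (if j ∈ s then ξ j else 0) - ξ j := by
        rw [← sum_basisVec_apply ξ s j]; rfl
      rw [h]
      split_ifs with hj
      · rw [sub_self, norm_zero]; exact (half_pos hε).le
      · rw [zero_sub, norm_neg]
        by_contra hcon
        refine hj (hs ?_)
        rw [Set.Finite.mem_toFinset]
        intro hlt
        exact hcon (by simpa using (show dist (ξ j) 0 < ε / 2 from hlt).le)
    obtain ⟨p, hp1⟩ := p
    subst hp
    exact lp.norm_le_of_forall_le
      (f := (∑ i ∈ s, ξ i • basisVec _ i - ξ : RegularSpace I _).toLp) (half_pos hε).le key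
  · have h := lp.hasSum_single (E := fun _ : I => ℂ) hp ξ.toLp
    have hind : Topology.IsInducing (RegularSpace.toLp (I := I) (p := p)) :=
      Topology.IsInducing.subtypeVal
    have hcomp : ∀ s : Finset I, (∑ i ∈ s, ξ i • basisVec p i).toLp =
        ∑ i ∈ s, lp.single (E := fun _ : I => ℂ) (p : ℝ≥0∞) i (ξ i) := by
      intro s
      rw [toLp_sum]
      refine Finset.sum_congr rfl fun i _ => ?_
      refine lp.ext (funext fun j => ?_)
      change ξ i * basisVec p i j = _
      by_cases hj : j = i
      · subst hj
        rw [basisVec_self, mul_one, lp.single_apply_self]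
      · rw [basisVec_ne hj, mul_zero, lp.single_apply_ne _ _ _ hj]
    rw [HasSum, hind.tendsto_nhds_iff]
    exact h.congr fun s => (hcomp s).symm

end RegularIsModel

variable [LocallyCompactSpace X] [T2Space X]

lemma exists_C0_one (x : X) : ∃ a : C₀(X, ℂ), a x = 1 := by
  obtain ⟨f, hf1, -, hfc, -⟩ := exists_continuous_one_zero_of_isCompact
    (isCompact_singleton (x := x)) isClosed_empty (Set.disjoint_empty _)
  let g : C(X, ℂ) := ⟨fun y => (f y : ℂ), by fun_prop⟩
  have hg : HasCompactSupport g := hfc.comp_left (g := fun r : ℝ => (r : ℂ)) (by simp)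
  exact ⟨⟨g, hg.is_zero_at_infty⟩, by simpa [g] using hf1 rfl⟩

lemma isNondegenerate_regularRep (u : Twist G X) (p : Exponent) :
    (regularRep u p).IsNondegenerate := by
  refine eq_top_iff.2 fun ξ _ => ?_
  refine mem_closure_of_tendsto (hasSum_basisVec ξ) (Eventually.of_forall fun s => ?_)
  refine Submodule.sum_mem _ fun q _ => Submodule.smul_mem _ _ (Submodule.subset_span ?_)
  obtain ⟨x, t⟩ := q
  obtain ⟨a, ha⟩ := exists_C0_one x
  refine ⟨UniversalAlgebra.single u 1 a, basisVec p (x, t), RegularSpace.ext fun q => ?_⟩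
  obtain ⟨y, r⟩ := q
  change _ = regularCLM u p _ _ _
  rw [regularCLM_single, regularOp_apply]
  simp only [inv_one, one_smul, one_mul, u.one_left, Circle.coe_one, mul_one]
  by_cases h : ((y, r) : X × G) = (x, t)
  · obtain ⟨rfl, rfl⟩ := Prod.mk.inj h
    rw [ha, one_mul]
  · rw [basisVec_ne h, mul_zero]

lemma reducedSeminorm_le_fullSeminorm (u : Twist G X) (p : Exponent) (b : UniversalAlgebra u) :
    reducedSeminorm u p b ≤ fullSeminorm u p b :=
  AlgSeminorm.le_sup (S := {N | ∃ (E : Type (max u v)) (_ : NormedAddCommGroup E)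
    (_ : NormedSpace ℂ E) (ψ : Representation u E), IsModelSpace p E ∧ ψ.IsNondegenerate ∧
      N = ψ.seminorm})
    ⟨RegularSpace (X × G) p, inferInstance, inferInstance, regularRep u p,
      isModelSpace_regularSpace, isNondegenerate_regularRep u p, rfl⟩ b

/-! ### The algebras `F^P(α,u)` and `F^P_r(α,u)` -/

open Classical in
/-- The norm `‖·‖_P = sup_{p ∈ P} ‖·‖_{L^p}` of `F^P(α,u)`, which for `P = ∅` is the norm of
`F(α,u)`. -/
def fullNorm (u : Twist G X) (P : Set Exponent) : AlgSeminorm u :=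
  if P = ∅ then AlgSeminorm.universal u else AlgSeminorm.sup (fullSeminorm u '' P)

open Classical in
/-- The norm `‖·‖_{P,r} = sup_{p ∈ P} ‖Λ_p(·)‖` of `F^P_r(α,u)`, which for `P = ∅` is the norm of
`F(α,u)`. -/
def reducedNorm (u : Twist G X) (P : Set Exponent) : AlgSeminorm u :=
  if P = ∅ then AlgSeminorm.universal u else AlgSeminorm.sup (reducedSeminorm u '' P)

lemma reducedNorm_le_fullNorm (u : Twist G X) (P : Set Exponent) (b : UniversalAlgebra u) :
    reducedNorm u P b ≤ fullNorm u P b := by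
  unfold reducedNorm fullNorm
  split_ifs with hP
  · exact le_rfl
  · refine AlgSeminorm.sup_le (AlgSeminorm.nonneg _ _) ?_
    rintro _ ⟨p, hp, rfl⟩
    exact (reducedSeminorm_le_fullSeminorm u p b).trans
      (AlgSeminorm.le_sup (Set.mem_image_of_mem _ hp) b)

/-- The full crossed product `F^P(α,u)`. -/
abbrev FullCrossedProduct (u : Twist G X) (P : Set Exponent) : Type (max u v) :=
  BanachCompletion (fullNorm u P)

/-- The reduced crossed product `F^P_r(α,u)`. -/
abbrev ReducedCrossedProduct (u : Twist G X) (P : Set Exponent) : Type (max u v) :=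
  BanachCompletion (reducedNorm u P)

/-- The regular representation `Λ_P : F^P(α,u) → F^P_r(α,u)`, the continuous extension of the
identity of `F(α,u)`. -/
def regularMap (u : Twist G X) (P : Set Exponent) :
    FullCrossedProduct u P →L[ℂ] ReducedCrossedProduct u P :=
  BanachCompletion.canonicalMap (reducedNorm_le_fullNorm u P)

/-! ### Ideals and intersection properties -/

section Ideals

variable {B : Type*} [NonUnitalNormedRing B] [NormedSpace ℂ B]

/-- `J` is an ideal of the Banach algebra `B`: a closed two-sided ideal. -/
structure IsBanachIdeal (J : Submodule ℂ B) : Prop where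
  isClosed : IsClosed (J : Set B)
  mul_mem_left : ∀ b, ∀ x ∈ J, b * x ∈ J
  mul_mem_right : ∀ b, ∀ x ∈ J, x * b ∈ J

/-- The inclusion `A ⊆ B` has the generalised intersection property with hidden ideal `K`: `K` is
the largest ideal of `B` with `K ∩ A = 0`. -/
def HasGeneralisedIntersectionProperty (A K : Submodule ℂ B) : Prop :=
  IsGreatest {J : Submodule ℂ B | IsBanachIdeal J ∧ J ⊓ A = ⊥} K

/-- `A` detects ideals in `B`: every non-zero ideal of `B` has non-zero intersection with `A`. -/
def DetectsIdeals (A : Submodule ℂ B) : Prop :=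
  ∀ J : Submodule ℂ B, IsBanachIdeal J → J ≠ ⊥ → J ⊓ A ≠ ⊥

end Ideals

end TwistedCrossedProduct

end

open TwistedCrossedProduct

noncomputable section

namespace TwistedCrossedProduct

open Filter Topology UniformSpace MeasureTheory
open scoped ZeroAtInfty ENNReal lp Pointwise

universe u v w

variable {G : Type v} {X : Type u} [Group G] [TopologicalSpace X] [MulAction G X]
  [ContinuousConstSMul G X] {u : Twist G X}

/-! ### Elements of `F(α,u)` -/

namespace UniversalAlgebra

/-! Everything is done for an arbitrary completion of `F(α,u)` in a seminorm `N` that dominates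
every coefficient norm `‖b(s)‖`. The coefficient maps then extend to the completion. The reduced
norms have this property because `b(s)(x)` is a matrix entry of `Λ_p(b)`, and the full norms inherit
it.

Suppose the action is topologically free and `J` is an ideal that meets `C_0(X)` trivially. If some
`c ∈ J` had a non-zero coefficient at `1`, one could scale it to be `1` at a point, approximate `c`
by a finitely supported `b`, and find nearby an open set `W` that the non-trivial part of the
support of `b` moves off itself. Compressing by a bump function `h` on `W` kills all coefficients of
`b` except the one at `1`, so `hch ∈ J` is close to `h²`. A Neumann series argument then puts a
non-zero function into `J`, a contradiction (`coeff_one_apply_ne_one_of_mem`). Translation gives the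
vanishing of all coefficients on `J` (`coeff_eq_zero_of_mem`). In a reduced crossed product an
element is determined by its coefficients (`reduced_eq_zero_of_coeff_eq_zero`), and `Λ_P` preserves
coefficients; so `J` is zero in the reduced case and lies in `ker Λ_P` in the full case.

Conversely, suppose `t ≠ 1` fixes an open set pointwise, and restrict to the cyclic group generated
by `t`. At a fixed point `x` the twist is a circle-valued cocycle of a cyclic group, hence trivial
(`exists_trivialisation`), and a trivialisation `W` gives the character `b ↦ ∑ b(s)(x) W(s)`. Since
cyclic groups have linear growth, taking powers shows that this character is contractive for `N`
(`norm_twistedEval_le`). If `W(t)` is chosen as a locally continuous function `w` of `x`, the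
elements `aδ_t - (aw)δ_1` are killed by all these characters. They lie in a non-zero ideal meeting
`C_0(X)` trivially (`exists_ideal_of_fixed`), which contradicts the remaining conditions. -/

@[simp] lemma zero_apply (r : G) : (0 : UniversalAlgebra u) r = 0 := rfl

@[simp] lemma sub_apply (a b : UniversalAlgebra u) (r : G) : (a - b) r = a r - b r := rfl

lemma norm_apply_le_norm (b : UniversalAlgebra u) (s : G) : ‖b s‖ ≤ ‖b‖ := by
  rw [norm_eq]
  exact b.summable_norm.le_tsum s fun _ _ => norm_nonneg _

lemma mul_single_apply (b : UniversalAlgebra u) (t : G) (a : C₀(X, ℂ)) (r : G) (x : X) :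
    (b * single u t a) r x =
      b (r * t⁻¹) x * a ((r * t⁻¹)⁻¹ • x) * (u.toFun (r * t⁻¹) t x : ℂ) := by
  rw [mul_apply, tsum_eq_single (r * t⁻¹)]
  · have h : (r * t⁻¹)⁻¹ * r = t := by group
    rw [h, single_apply_self, coeffMul_apply]
  · intro s hs
    rw [single_apply_ne a]
    · ext x; simp
    · intro h; exact hs (by rw [← h]; group)

lemma single_mul_apply (b : UniversalAlgebra u) (t : G) (a : C₀(X, ℂ)) (r : G) (x : X) :
    (single u t a * b) r x = a x * b (t⁻¹ * r) (t⁻¹ • x) * (u.toFun t (t⁻¹ * r) x : ℂ) := by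
  rw [mul_apply, tsum_eq_single t]
  · rw [single_apply_self, coeffMul_apply]
  · intro s hs
    rw [single_apply_ne a hs]
    ext x; simp

/-- Evaluation of the coefficient at `s`. -/
def coeffL (u : Twist G X) (s : G) : UniversalAlgebra u →ₗ[ℂ] C₀(X, ℂ) where
  toFun b := b s
  map_add' _ _ := rfl
  map_smul' _ _ := rfl

/-- The finitely supported truncation of `b` to `F`. -/
def truncate (b : UniversalAlgebra u) (F : Finset G) : UniversalAlgebra u :=
  ∑ s ∈ F, single u s (b s)

lemma truncate_apply_of_notMem (b : UniversalAlgebra u) {F : Finset G} {s : G} (hs : s ∉ F) :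
    b.truncate F s = 0 := by
  change coeffL u s (∑ r ∈ F, single u r (b r)) = 0
  rw [map_sum]
  exact Finset.sum_eq_zero fun r hr => single_apply_ne (u := u) _ fun h => hs (h ▸ hr)

lemma tendsto_truncate (b : UniversalAlgebra u) : Tendsto b.truncate atTop (𝓝 b) := by
  have h := hasSum_single b
  rwa [HasSum, SummationFilter.unconditional_filter] at h

end UniversalAlgebra

/-! ### Coefficients of elements of completions -/

/-- The seminorm `N` dominates the norms of all coefficients. -/
def AlgSeminorm.DominatesCoefficients (N : AlgSeminorm u) : Prop :=
  ∀ (b : UniversalAlgebra u) (s : G), ‖b s‖ ≤ N b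

namespace BanachCompletion

variable {N : AlgSeminorm u}

/-- The continuous extension to the completion of a linear map that is contractive for `N`. -/
def lift {E : Type*} [NormedAddCommGroup E] [NormedSpace ℂ E] [CompleteSpace E]
    (f : UniversalAlgebra u →ₗ[ℂ] E) (hf : ∀ a, ‖f a‖ ≤ N a) : BanachCompletion N →L[ℂ] E :=
  (LinearMap.mkContinuous (𝕜 := ℂ) (σ := RingHom.id ℂ) (E := SeminormedAlgebra N) (F := E)
    { toFun := fun a => f a
      map_add' := fun a b => f.map_add a b
      map_smul' := fun c a => f.map_smul c a } 1
    (fun a => by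
      rw [one_mul]
      exact hf a)).extend (coeL N)

lemma lift_of {E : Type*} [NormedAddCommGroup E] [NormedSpace ℂ E] [CompleteSpace E]
    (f : UniversalAlgebra u →ₗ[ℂ] E) (hf : ∀ a, ‖f a‖ ≤ N a) (a : UniversalAlgebra u) :
    lift f hf (of N a) = f a :=
  ContinuousLinearMap.extend_eq _ (denseRange_coeL N) (isUniformInducing_coeL N) a

lemma exists_norm_sub_of_lt (c : BanachCompletion N) {ε : ℝ} (hε : 0 < ε) :
    ∃ b : UniversalAlgebra u, ‖c - of N b‖ < ε := by
  obtain ⟨b, hb⟩ := (denseRange_of N).exists_dist_lt c hε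
  exact ⟨b, by rwa [← dist_eq_norm]⟩

/-- The extension to the completion of the map `b ↦ b(s)`. -/
def coeff (hN : N.DominatesCoefficients) (s : G) : BanachCompletion N →L[ℂ] C₀(X, ℂ) :=
  lift (UniversalAlgebra.coeffL u s) fun b => hN b s

lemma coeff_of (hN : N.DominatesCoefficients) (s : G) (b : UniversalAlgebra u) :
    coeff hN s (of N b) = b s :=
  lift_of _ _ b

lemma continuous_coeff_apply (hN : N.DominatesCoefficients) (s : G) (x : X) :
    Continuous fun c : BanachCompletion N => coeff hN s c x := by
  have h : Continuous fun a : C₀(X, ℂ) => a x :=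
    (BoundedContinuousFunction.evalCLM ℂ x).continuous.comp
      ZeroAtInftyContinuousMap.isometry_toBCF.continuous
  exact h.comp (coeff hN s).continuous

lemma norm_coeff_apply_le (hN : N.DominatesCoefficients) (s : G) (c : BanachCompletion N) (x : X) :
    ‖coeff hN s c x‖ ≤ ‖c‖ := by
  refine induction_on c ?_ fun a => ?_
  · exact isClosed_le (continuous_coeff_apply hN s x).norm continuous_norm
  · rw [coeff_of, norm_of]
    exact (norm_apply_le _ x).trans (hN a s)

lemma coeff_mul_single (hN : N.DominatesCoefficients) (c : BanachCompletion N) (t : G)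
    (a : C₀(X, ℂ)) (r : G) (x : X) :
    coeff hN r (c * of N (UniversalAlgebra.single u t a)) x =
      coeff hN (r * t⁻¹) c x * a ((r * t⁻¹)⁻¹ • x) * (u.toFun (r * t⁻¹) t x : ℂ) := by
  refine induction_on c ?_ fun b => ?_
  · exact isClosed_eq ((continuous_coeff_apply hN r x).comp (continuous_id.mul continuous_const))
      (((continuous_coeff_apply hN _ x).mul continuous_const).mul continuous_const)
  · rw [← of_mul, coeff_of, coeff_of, UniversalAlgebra.mul_single_apply]

lemma coeff_single_mul (hN : N.DominatesCoefficients) (c : BanachCompletion N) (t : G)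
    (a : C₀(X, ℂ)) (r : G) (x : X) :
    coeff hN r (of N (UniversalAlgebra.single u t a) * c) x =
      a x * coeff hN (t⁻¹ * r) c (t⁻¹ • x) * (u.toFun t (t⁻¹ * r) x : ℂ) := by
  refine induction_on c ?_ fun b => ?_
  · exact isClosed_eq ((continuous_coeff_apply hN r x).comp (continuous_const.mul continuous_id))
      ((continuous_const.mul (continuous_coeff_apply hN _ _)).mul continuous_const)
  · rw [← of_mul, coeff_of, coeff_of, UniversalAlgebra.single_mul_apply]

lemma eq_top_of_single_mem {S : Submodule ℂ (BanachCompletion N)}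
    (hS : IsClosed (S : Set (BanachCompletion N)))
    (h : ∀ s a, of N (UniversalAlgebra.single u s a) ∈ S) : S = ⊤ := by
  refine eq_top_iff.2 fun c _ => induction_on (p := fun c => c ∈ S) c hS fun b => ?_
  have hb := (of N).continuous.continuousAt.tendsto.comp (UniversalAlgebra.tendsto_truncate b)
  refine hS.mem_of_tendsto hb (Eventually.of_forall fun F => ?_)
  change of N (∑ s ∈ F, UniversalAlgebra.single u s (b s)) ∈ S
  rw [map_sum]
  exact S.sum_mem fun s _ => h s _

/-- The elements `aδ_s` span a dense subspace and `J` is closed, so stability under multiplication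
by them suffices. -/
lemma isBanachIdeal_of_single {J : Submodule ℂ (BanachCompletion N)}
    (hJ : IsClosed (J : Set (BanachCompletion N)))
    (hl : ∀ s a, ∀ c ∈ J, of N (UniversalAlgebra.single u s a) * c ∈ J)
    (hr : ∀ s a, ∀ c ∈ J, c * of N (UniversalAlgebra.single u s a) ∈ J) : IsBanachIdeal J where
  isClosed := hJ
  mul_mem_left b c hc := by
    have h := eq_top_of_single_mem (S := J.comap (LinearMap.mulRight ℂ c))
      (hJ.preimage (continuous_id.mul continuous_const)) fun s a => hl s a c hc
    exact (h ▸ Submodule.mem_top : b ∈ J.comap (LinearMap.mulRight ℂ c))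
  mul_mem_right b c hc := by
    have h := eq_top_of_single_mem (S := J.comap (LinearMap.mulLeft ℂ c))
      (hJ.preimage (continuous_const.mul continuous_id)) fun s a => hr s a c hc
    exact (h ▸ Submodule.mem_top : b ∈ J.comap (LinearMap.mulLeft ℂ c))

end BanachCompletion

/-! ### Coefficients of elements of reduced crossed products -/

/-- Only `s = rt⁻¹` contributes to the sum defining `Λ_p(b)`, so each matrix entry sees a single
coefficient of `b`. This both bounds the coefficients and recovers the operator from them. -/
lemma regularCLM_basisVec (p : Exponent) (b : UniversalAlgebra u) (x y : X) (t r : G) :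
    regularCLM u p b (basisVec p (x, t)) (y, r) =
      b (r * t⁻¹) y * ((u.toFun (r * t⁻¹) t y : ℂ) * basisVec p (x, t) ((r * t⁻¹)⁻¹ • y, t)) := by
  have h := regularRep_apply p b (basisVec p (x, t)) y r
  refine h.trans ?_
  rw [tsum_eq_single (r * t⁻¹)]
  · have h : (r * t⁻¹)⁻¹ * r = t := by group
    rw [h, mul_assoc]
  · intro s hs
    rw [basisVec_ne, mul_zero]
    intro h
    refine hs ?_
    rw [← (Prod.mk.inj h).2]
    group

lemma norm_basisVec {I : Type w} (p : Exponent) (i : I) : ‖basisVec p i‖ = 1 := by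
  classical
  have h := lp.norm_single (E := fun _ : I => ℂ) (p := (p : ℝ≥0∞))
    (zero_lt_one.trans_le p.2) i 1
  rw [norm_one] at h
  exact h

lemma dominatesCoefficients_reducedSeminorm (u : Twist G X) (p : Exponent) :
    (reducedSeminorm u p).DominatesCoefficients := by
  intro b s
  refine norm_le_of_apply (AlgSeminorm.nonneg _ _) fun x => ?_
  -- With column `(s⁻¹x, 1)` and row `(x, s)` the cocycle factor is `u(s,1) = 1`, so the entry is
  -- exactly `b(s)(x)`.
  have h := regularCLM_basisVec p b (s⁻¹ • x) x 1 s
  simp only [inv_one, mul_one, basisVec_self, u.one_right, Circle.coe_one] at h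
  rw [← h]
  refine (RegularSpace.norm_apply_le _ _).trans ?_
  refine ((regularCLM u p b).le_opNorm _).trans ?_
  rw [norm_basisVec, mul_one]
  exact le_rfl

lemma dominatesCoefficients_reducedNorm (u : Twist G X) (P : Set Exponent) :
    (reducedNorm u P).DominatesCoefficients := by
  intro b s
  unfold reducedNorm
  split_ifs with hP
  · exact b.norm_apply_le_norm s
  · obtain ⟨p, hp⟩ := Set.nonempty_iff_ne_empty.2 hP
    exact (dominatesCoefficients_reducedSeminorm u p b s).trans
      (AlgSeminorm.le_sup (Set.mem_image_of_mem _ hp) b)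

lemma dominatesCoefficients_fullNorm [LocallyCompactSpace X] [T2Space X] (u : Twist G X) (P : Set Exponent) :
    (fullNorm u P).DominatesCoefficients := fun b s =>
  (dominatesCoefficients_reducedNorm u P b s).trans (reducedNorm_le_fullNorm u P b)

/-- Basis expansions converge in norm, also for `p = ∞`, because the space is then `c_0` and not
`ℓ^∞`. -/
lemma RegularSpace.clm_ext {I : Type w} {p : Exponent}
    {S T : RegularSpace I p →L[ℂ] RegularSpace I p}
    (h : ∀ i j, S (basisVec p i) j = T (basisVec p i) j) : S = T := by
  ext1 ξ
  have hS := (hasSum_basisVec ξ).mapL S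
  have hT := (hasSum_basisVec ξ).mapL T
  rw [← hS.tsum_eq, ← hT.tsum_eq]
  refine tsum_congr fun i => ?_
  rw [map_smul, map_smul, RegularSpace.ext (h i)]

open BanachCompletion in
-- For `P ≠ ∅` the extension of each `Λ_p` to the completion has matrix entries given by
-- coefficients, so it annihilates `c`; the norm is the supremum of the norms of these operators.
lemma reduced_eq_zero_of_coeff_eq_zero (P : Set Exponent)
    (c : ReducedCrossedProduct u P)
    (hc : ∀ s, coeff (dominatesCoefficients_reducedNorm u P) s c = 0) : c = 0 := by
  by_contra hne
  have hpos : 0 < ‖c‖ := norm_pos_iff.2 hne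
  obtain ⟨b, hb⟩ := exists_norm_sub_of_lt c (half_pos hpos)
  -- This would give `‖c‖ ≤ 2‖c - b‖ < ‖c‖`. Working with the approximant `b` makes it enough to
  -- know the norm on `F(α,u)`, where it is defined as a supremum.
  suffices h : reducedNorm u P b ≤ ‖c - of (reducedNorm u P) b‖ by
    rw [← norm_of] at h
    have h2 := norm_add_le (c - of (reducedNorm u P) b) (of (reducedNorm u P) b)
    rw [sub_add_cancel] at h2
    linarith
  -- For `P = ∅` the norm is the complete `ℓ¹`-norm, so the completion adds nothing and `c` itself
  -- comes from `F(α,u)`.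
  by_cases hP : P = ∅
  · have hiso : ∀ a, ‖of (reducedNorm u P) a‖ = ‖a‖ := fun a => by
      rw [norm_of, reducedNorm, if_pos hP, AlgSeminorm.universal_apply]
    have hrange : IsClosed (Set.range (of (reducedNorm u P))) :=
      (AddMonoidHomClass.isometry_of_norm _ hiso).isClosedEmbedding.isClosed_range
    obtain ⟨a, rfl⟩ : c ∈ Set.range (of (reducedNorm u P)) := by
      rw [← hrange.closure_eq]
      exact denseRange_of _ c
    refine (hne ?_).elim
    have ha : a = 0 := UniversalAlgebra.ext fun s => by
      rw [← coeff_of (dominatesCoefficients_reducedNorm u P), hc]; rfl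
    rw [ha, map_zero]
  · have hle : ∀ p ∈ P, ∀ a, ‖regularCLM u p a‖ ≤ reducedNorm u P a := fun p hp a => by
      rw [reducedNorm, if_neg hP]
      exact AlgSeminorm.le_sup (Set.mem_image_of_mem (reducedSeminorm u) hp) a
    have key : ∀ p (hp : p ∈ P), lift (regularCLM u p).toLinearMap (hle p hp) c = 0 := by
      intro p hp
      have hform : ∀ (d : ReducedCrossedProduct u P) (x y : X) (t r : G),
          lift (regularCLM u p).toLinearMap (hle p hp) d (basisVec p (x, t)) (y, r) =
            coeff (dominatesCoefficients_reducedNorm u P) (r * t⁻¹) d y *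
            ((u.toFun (r * t⁻¹) t y : ℂ) * basisVec p (x, t) ((r * t⁻¹)⁻¹ • y, t)) := by
        intro d x y t r
        refine induction_on d ?_ fun a => ?_
        · refine isClosed_eq ?_ ((continuous_coeff_apply _ _ y).mul continuous_const)
          exact ((evalCLM (p := p) (y, r)).comp (ContinuousLinearMap.apply ℂ
            (RegularSpace (X × G) p) (basisVec p (x, t)))).continuous.comp
              (lift (regularCLM u p).toLinearMap (hle p hp)).continuous
        · rw [lift_of, coeff_of]
          exact regularCLM_basisVec p a x y t r
      refine RegularSpace.clm_ext fun i j => ?_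
      rw [hform, hc]
      exact zero_mul _
    have hlift : ∀ p (hp : p ∈ P) (d : ReducedCrossedProduct u P),
        ‖lift (regularCLM u p).toLinearMap (hle p hp) d‖ ≤ ‖d‖ := fun p hp d => by
      refine induction_on d ?_ fun a => ?_
      · exact isClosed_le (lift _ (hle p hp)).continuous.norm continuous_norm
      · rw [lift_of, norm_of]
        exact hle p hp a
    have hsup : reducedNorm u P b = AlgSeminorm.sup (reducedSeminorm u '' P) b := by
      rw [reducedNorm, if_neg hP]
    rw [hsup]
    refine AlgSeminorm.sup_le (norm_nonneg _) ?_
    rintro _ ⟨p, hp, rfl⟩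
    have h := hlift p hp (c - of (reducedNorm u P) b)
    rw [map_sub, key p hp, lift_of, zero_sub, norm_neg] at h
    exact h

/-! ### Ideals with trivial intersection with the coefficient algebra -/

/-- Modulo `J` one has `k ≡ dk ≡ d²k ≡ …`, and `dⁿk → 0` while `J` is closed. This replaces
inverting `1 - d` in an algebra without unit. -/
lemma IsBanachIdeal.mem_of_sub_mul_mem {B : Type*} [NonUnitalNormedRing B] [NormedSpace ℂ B]
    {J : Submodule ℂ B} (hJ : IsBanachIdeal J) {d k : B} (hd : ‖d‖ < 1) (h : k - d * k ∈ J) :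
    k ∈ J := by
  let z : ℕ → B := fun n => (d * ·)^[n] k
  have hz : ∀ n, z (n + 1) = d * z n := fun n => Function.iterate_succ_apply' _ _ _
  have hmem : ∀ n, k - z n ∈ J := by
    intro n
    induction n with
    | zero => simp [z]
    | succ n ih =>
      have h2 := J.add_mem h (hJ.mul_mem_left d _ ih)
      rwa [mul_sub, ← hz, sub_add_sub_cancel] at h2
  have hnorm : ∀ n, ‖z n‖ ≤ ‖d‖ ^ n * ‖k‖ := by
    intro n
    induction n with
    | zero => simp [z]
    | succ n ih =>
      rw [hz, pow_succ', mul_assoc]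
      exact (norm_mul_le _ _).trans (mul_le_mul_of_nonneg_left ih (norm_nonneg _))
  have hlim : Tendsto z atTop (𝓝 0) := by
    refine squeeze_zero_norm hnorm ?_
    simpa using (tendsto_pow_atTop_nhds_zero_of_lt_one (norm_nonneg d) hd).mul_const ‖k‖
  have h2 := (tendsto_const_nhds (x := k)).sub hlim
  rw [sub_zero] at h2
  exact hJ.isClosed.mem_of_tendsto h2 (Eventually.of_forall hmem)

/-- The plateau `V` leaves room for a second bump function supported in `V`, on which the first acts
as a unit. -/
lemma exists_bump [LocallyCompactSpace X] [T2Space X] {W : Set X} (hW : IsOpen W) {x : X}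
    (hx : x ∈ W) : ∃ (h : C₀(X, ℂ)) (V : Set X), IsOpen V ∧ x ∈ V ∧ V ⊆ W ∧ (∀ y ∈ V, h y = 1) ∧
      tsupport h ⊆ W ∧ IsCompact (tsupport h) ∧ ∀ y, ‖h y‖ ≤ 1 := by
  obtain ⟨K, hK, hxK, hKW⟩ := exists_compact_subset hW hx
  obtain ⟨f, hf1, hfc, hfW, hf⟩ := exists_continuousMap_one_of_isCompact_subset_isOpen hK hW hKW
  let g : C(X, ℂ) := ⟨fun y => (f y : ℂ), by fun_prop⟩
  have hfc' : HasCompactSupport f := hfc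
  have hg : HasCompactSupport g := hfc'.comp_left (g := fun r : ℝ => (r : ℂ)) (by simp)
  have hts : tsupport g ⊆ tsupport f :=
    closure_mono fun y hy hy' => hy (by change (f y : ℂ) = 0; rw [hy', Complex.ofReal_zero])
  refine ⟨⟨g, hg.is_zero_at_infty⟩, interior K, isOpen_interior, hxK,
    interior_subset.trans hKW, fun y hy => ?_, hts.trans hfW, hg, fun y => ?_⟩
  · change (f y : ℂ) = 1
    rw [hf1 (interior_subset hy)]
    simp
  · change ‖(f y : ℂ)‖ ≤ 1
    rw [Complex.norm_real, Real.norm_of_nonneg (hf y).1]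
    exact (hf y).2

/-- The non-fixed sets of the `s ≠ 1` in `F` are open and dense, so their finite intersection is
dense and meets `V`. -/
lemma IsTopologicallyFree.exists_mem [LocallyCompactSpace X] [T2Space X]
    (hfree : IsTopologicallyFree G X) (F : Finset G) {V : Set X} (hV : IsOpen V)
    (hne : V.Nonempty) : ∃ x ∈ V, ∀ s ∈ F, s ≠ 1 → s • x ≠ x := by
  have hd : Dense (⋂ s ∈ {s : G | s ∈ F ∧ s ≠ 1}, {x : X | s • x = x}ᶜ) := by
    refine dense_biInter_of_isOpen (fun s _ => ?_) ?_ fun s hs => ?_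
    · exact (isClosed_eq (continuous_const_smul s) continuous_id).isOpen_compl
    · exact (F.finite_toSet.subset fun s hs => hs.1).countable
    · exact interior_eq_empty_iff_dense_compl.1 (hfree s hs.2)
  obtain ⟨x, hxV, hx⟩ := hd.inter_open_nonempty V hV hne
  refine ⟨x, hxV, fun s hs hs1 => ?_⟩
  exact Set.mem_iInter₂.1 hx s ⟨hs, hs1⟩

/-- For each relevant `s`, separate `x` from `s⁻¹x` and pull back by continuity; `F` is finite, so
the resulting neighbourhoods can be intersected. -/
lemma exists_wandering_nhds [T2Space X] (F : Finset G) {V : Set X} (hV : IsOpen V) {x : X}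
    (hx : x ∈ V) (hfix : ∀ s ∈ F, s ≠ 1 → s • x ≠ x) :
    ∃ W ⊆ V, IsOpen W ∧ x ∈ W ∧ ∀ s ∈ F, s ≠ 1 → ∀ y ∈ W, s⁻¹ • y ∉ W := by
  have h : ∀ s : G, ∃ W : Set X, IsOpen W ∧ x ∈ W ∧
      (s ∈ F → s ≠ 1 → ∀ y ∈ W, s⁻¹ • y ∉ W) := by
    intro s
    by_cases hs : s ∈ F ∧ s ≠ 1
    · have hne : x ≠ s⁻¹ • x := fun h => hfix s hs.1 hs.2 (by rw [eq_inv_smul_iff] at h; exact h)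
      obtain ⟨A, B, hA, hB, hxA, hxB, hAB⟩ := t2_separation hne
      refine ⟨A ∩ (s⁻¹ • ·) ⁻¹' B, hA.inter (hB.preimage (continuous_const_smul _)), ⟨hxA, hxB⟩,
        fun _ _ y hy hy' => ?_⟩
      exact Set.disjoint_left.1 hAB hy'.1 hy.2
    · exact ⟨Set.univ, isOpen_univ, trivial, fun h1 h2 => (hs ⟨h1, h2⟩).elim⟩
  choose W hWo hxW hW using h
  refine ⟨V ∩ ⋂ s ∈ F, W s, Set.inter_subset_left,
    hV.inter (isOpen_biInter_finset fun s _ => hWo s),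
    ⟨hx, Set.mem_iInter₂.2 fun s _ => hxW s⟩, fun s hs hs1 y hy hy' => ?_⟩
  exact hW s hs hs1 y (Set.mem_iInter₂.1 hy.2 s hs) (Set.mem_iInter₂.1 hy'.2 s hs)

namespace BanachCompletion

open UniversalAlgebra

variable [LocallyCompactSpace X] [T2Space X] {N : AlgSeminorm u}
  (hN : N.DominatesCoefficients) (hfree : IsTopologicallyFree G X)
  {J : Submodule ℂ (BanachCompletion N)} (hJ : IsBanachIdeal J) (hJA : J ⊓ coefficients N = ⊥)
include hN hfree hJ hJA

/-- A coefficient equal to `1` somewhere would allow a compression of `c` to be so close to `h²`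
that `J` contains a non-zero function. -/
lemma coeff_one_apply_ne_one_of_mem {c : BanachCompletion N} (hc : c ∈ J) (x₀ : X) :
    coeff hN 1 c x₀ ≠ 1 := by
  intro hone
  -- Two errors of size `1/4` occur below, from `c` to `b` and from `b(1)` to `1`; together they
  -- stay below `1`.
  obtain ⟨b₀, hb₀⟩ := exists_norm_sub_of_lt c (ε := 1 / 4) (by norm_num)
  have hlim : Tendsto (fun F => ‖c - of N (b₀.truncate F)‖) atTop (𝓝 ‖c - of N b₀‖) :=
    (((of N).continuous.tendsto b₀).comp (tendsto_truncate b₀)).const_sub c |>.norm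
  obtain ⟨F, hF⟩ := (hlim.eventually_lt_const hb₀).exists
  set b := b₀.truncate F with hb
  have hb1 : ‖b 1 x₀ - 1‖ < 1 / 4 := by
    have h := norm_coeff_apply_le hN 1 (c - of N b) x₀
    rw [map_sub, coeff_of, ZeroAtInftyContinuousMap.sub_apply, hone, norm_sub_rev] at h
    exact h.trans_lt hF
  have hVo : IsOpen {y : X | ‖b 1 y - 1‖ < 1 / 4} :=
    isOpen_lt (((map_continuous (b 1)).sub continuous_const).norm) continuous_const
  obtain ⟨x, hxV, hx⟩ := hfree.exists_mem F hVo ⟨x₀, hb1⟩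
  obtain ⟨W, hWV, hWo, hxW, hW⟩ := exists_wandering_nhds F hVo hxV hx
  obtain ⟨h, V, hV, hxV', -, hh1, hhW, -, hhn⟩ := exists_bump hWo hxW
  obtain ⟨k, _, _, hxk, _, hk1, hkV, _, _⟩ := exists_bump hV hxV'
  have hh0 : ∀ y ∉ W, h y = 0 := fun y hy => image_eq_zero_of_notMem_tsupport fun h => hy (hhW h)
  have hhk : h * h * k = k := by
    ext y
    by_cases hy : y ∈ V
    · simp [hh1 y hy]
    · have : k y = 0 := image_eq_zero_of_notMem_tsupport fun h => hy (hkV h)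
      simp [this]
  -- The coefficient of `hbh` at `s` carries the factor `h(y) h(s⁻¹y)`, which vanishes for `s ≠ 1`
  -- in `F` because `h` lives on the wandering set `W`.
  have hcomp : single u 1 h * b * single u 1 h = single u 1 (h * b 1 * h) := by
    ext s y
    rw [mul_single_apply, single_mul_apply]
    simp only [inv_one, mul_one, one_mul, one_smul, u.one_left, u.one_right, Circle.coe_one]
    by_cases hs : s = 1
    · subst hs
      rw [single_apply_self]
      simp
    · rw [single_apply_ne _ hs, ZeroAtInftyContinuousMap.zero_apply]
      by_cases hsF : s ∈ F
      · by_cases hy : y ∈ W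
        · rw [hh0 _ (hW s hsF hs y hy), mul_zero]
        · rw [hh0 _ hy, zero_mul, zero_mul]
      · rw [hb, truncate_apply_of_notMem _ hsF]
        simp
  have hnh : ‖of N (single u 1 h)‖ ≤ 1 := by
    rw [norm_of]
    exact (N.le_norm _).trans (by
      rw [norm_single]; exact norm_le_of_apply zero_le_one hhn)
  set j := of N (single u 1 h) * c * of N (single u 1 h) with hj
  have hjJ : j ∈ J := hJ.mul_mem_right _ _ (hJ.mul_mem_left _ _ hc)
  have hd : ‖of N (single u 1 (h * h)) - j‖ < 1 := by
    have h1 : ‖of N (single u 1 (h * h)) - of N (single u 1 (h * b 1 * h))‖ ≤ 1 / 4 := by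
      rw [← map_sub, ← map_sub, norm_of]
      refine (N.le_norm _).trans ?_
      rw [norm_single]
      refine norm_le_of_apply (by norm_num) fun y => ?_
      have e : (h * h - h * b 1 * h) y = h y * (1 - b 1 y) * h y := by
        simp; ring
      rw [e, norm_mul, norm_mul]
      by_cases hy : y ∈ W
      · have h3 : ‖1 - b 1 y‖ < 1 / 4 := by rw [norm_sub_rev]; exact hWV hy
        calc _ ≤ 1 * ‖1 - b 1 y‖ * 1 := by gcongr <;> exact hhn y
          _ ≤ 1 / 4 := by linarith
      · rw [hh0 y hy]; norm_num
    have h2 : ‖of N (single u 1 (h * b 1 * h)) - j‖ ≤ 1 / 4 := by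
      rw [← hcomp, of_mul, of_mul, hj, ← sub_mul, ← mul_sub]
      calc _ ≤ ‖of N (single u 1 h)‖ * ‖of N b - c‖ * ‖of N (single u 1 h)‖ :=
            (norm_mul_le _ _).trans (mul_le_mul_of_nonneg_right (norm_mul_le _ _) (norm_nonneg _))
        _ ≤ 1 * ‖of N b - c‖ * 1 := by gcongr
        _ ≤ 1 / 4 := by rw [norm_sub_rev, one_mul, mul_one]; exact hF.le
    have h3 := norm_sub_le_norm_sub_add_norm_sub (of N (single u 1 (h * h)))
      (of N (single u 1 (h * b 1 * h))) j
    linarith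
  have hkJ : of N (single u 1 k) ∈ J := by
    -- Take `d = h² - j`. As `h²k = k`, the difference `k - dk` equals `jk`, which is in `J`.
    refine hJ.mem_of_sub_mul_mem hd ?_
    have h1 : of N (single u 1 (h * h)) * of N (single u 1 k) = of N (single u 1 k) := by
      rw [← of_mul, single_mul_single, mul_one]
      congr 2
      ext y
      simp only [coeffMul_apply, inv_one, one_smul, u.one_left, Circle.coe_one, mul_one]
      exact DFunLike.congr_fun hhk y
    rw [sub_mul, h1, sub_sub_cancel]
    exact hJ.mul_mem_right _ _ hjJ
  have hk0 : of N (single u 1 k) ∈ J ⊓ coefficients N := ⟨hkJ, k, rfl⟩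
  rw [hJA, Submodule.mem_bot] at hk0
  have h := congrArg (fun d => coeff hN 1 d x) hk0
  simp only [coeff_of, single_apply_self, map_zero, hk1 x hxk] at h
  exact one_ne_zero h

/-- Rescaling a non-zero value to `1` settles the coefficient at `1`. Right multiplication by
`aδ_{s⁻¹}` with `a(s⁻¹x) = 1` moves the coefficient at `s` to `1`, up to a unimodular factor. -/
lemma coeff_eq_zero_of_mem {c : BanachCompletion N} (hc : c ∈ J) (s : G) : coeff hN s c = 0 := by
  have hone : ∀ d ∈ J, ∀ x, coeff hN 1 d x = 0 := by
    intro d hd x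
    by_contra hne
    refine coeff_one_apply_ne_one_of_mem hN hfree hJ hJA
      (J.smul_mem (coeff hN 1 d x)⁻¹ hd) x ?_
    rw [map_smul, ZeroAtInftyContinuousMap.smul_apply, smul_eq_mul, inv_mul_cancel₀ hne]
  ext x
  obtain ⟨a, ha⟩ := exists_C0_one (s⁻¹ • x)
  have h := hone _ (hJ.mul_mem_right (of N (single u s⁻¹ a)) _ hc) x
  rw [coeff_mul_single, one_mul, inv_inv, ha, mul_one] at h
  exact (mul_eq_zero.1 h).resolve_right (Circle.coe_ne_zero _)

end BanachCompletion

/-! ### Trivialising a twist over a cyclic group at a fixed point -/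

/-- The central extension of `G` by the circle that is defined by the values of the twist at a
point `x` fixed by `G`. -/
@[ext] structure FixedPointExtension (u : Twist G X) (x : X) (_hx : ∀ g : G, g • x = x) where
  /-- the component in the circle -/
  fst : Circle
  /-- the component in the group -/
  snd : G

namespace FixedPointExtension

variable {x : X} {hx : ∀ g : G, g • x = x}

/-- With the inverse of `u` in the product, `s ↦ (W(s), s)` is multiplicative exactly when `W(s)W(r)
= u(s,r)(x) W(sr)`. -/
instance : Mul (FixedPointExtension u x hx) :=
  ⟨fun p q => ⟨p.fst * q.fst * (u.toFun p.snd q.snd x)⁻¹, p.snd * q.snd⟩⟩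

instance : One (FixedPointExtension u x hx) := ⟨⟨1, 1⟩⟩

instance : Inv (FixedPointExtension u x hx) :=
  ⟨fun p => ⟨p.fst⁻¹ * u.toFun p.snd⁻¹ p.snd x, p.snd⁻¹⟩⟩

@[simp] lemma mul_fst (p q : FixedPointExtension u x hx) :
    (p * q).fst = p.fst * q.fst * (u.toFun p.snd q.snd x)⁻¹ := rfl

@[simp] lemma mul_snd (p q : FixedPointExtension u x hx) : (p * q).snd = p.snd * q.snd := rfl

@[simp] lemma one_fst : (1 : FixedPointExtension u x hx).fst = 1 := rfl

@[simp] lemma one_snd : (1 : FixedPointExtension u x hx).snd = 1 := rfl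

@[simp] lemma inv_fst (p : FixedPointExtension u x hx) :
    p⁻¹.fst = p.fst⁻¹ * u.toFun p.snd⁻¹ p.snd x := rfl

@[simp] lemma inv_snd (p : FixedPointExtension u x hx) : p⁻¹.snd = p.snd⁻¹ := rfl

/-- Associativity is the cocycle identity at `x`, where the translation by `r⁻¹` disappears because
`x` is fixed. -/
instance : Group (FixedPointExtension u x hx) :=
  Group.ofLeftAxioms
    (fun p q r => by
      refine FixedPointExtension.ext ?_ (mul_assoc _ _ _)
      have h := u.cocycle p.snd q.snd r.snd x
      rw [hx] at h
      have h2 : (u.toFun p.snd q.snd x)⁻¹ * (u.toFun (p.snd * q.snd) r.snd x)⁻¹ =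
          (u.toFun q.snd r.snd x)⁻¹ * (u.toFun p.snd (q.snd * r.snd) x)⁻¹ := by
        rw [← mul_inv, ← mul_inv, h]
      simp only [mul_fst, mul_snd]
      calc _ = p.fst * q.fst * r.fst *
            ((u.toFun p.snd q.snd x)⁻¹ * (u.toFun (p.snd * q.snd) r.snd x)⁻¹) := by
              simp only [mul_assoc, mul_left_comm]
        _ = _ := by
              rw [h2]
              simp only [mul_assoc])
    (fun p => FixedPointExtension.ext (by simp [u.one_left]) (by simp))
    (fun p => FixedPointExtension.ext (by simp [mul_comm]) (by simp))

/-- The projection of the extension onto `G`. -/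
def sndHom (u : Twist G X) (x : X) (hx : ∀ g : G, g • x = x) :
    FixedPointExtension u x hx →* G where
  toFun := snd
  map_one' := rfl
  map_mul' _ _ := rfl

lemma pow_eq (w : Circle) (t : G) (n : ℕ) :
    (⟨w, t⟩ : FixedPointExtension u x hx) ^ n =
      ⟨w ^ n * (∏ j ∈ Finset.range n, u.toFun (t ^ j) t x)⁻¹, t ^ n⟩ := by
  induction n with
  | zero => refine FixedPointExtension.ext ?_ ?_ <;> simp
  | succ n ih =>
    rw [pow_succ, ih]
    refine FixedPointExtension.ext ?_ (pow_succ _ _).symm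
    rw [mul_fst, Finset.prod_range_succ, pow_succ, mul_inv]
    simp only [mul_assoc, mul_left_comm]

end FixedPointExtension

/-- The condition on `w` says that the lift `e = (w, t)` of the generator satisfies `e ^ orderOf t =
1`, so `t^k ↦ e^k` splits the extension and `W` is its circle component. For `t` of infinite order,
`orderOf t = 0` and the condition reads `1 = 1`. -/
lemma exists_trivialisation (u : Twist G X) {x : X} (hx : ∀ g : G, g • x = x) {t : G}
    (ht : ∀ g, g ∈ Subgroup.zpowers t) {w : Circle}
    (hw : w ^ orderOf t = ∏ j ∈ Finset.range (orderOf t), u.toFun (t ^ j) t x) :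
    ∃ W : G → Circle, (∀ s r, W s * W r = u.toFun s r x * W (s * r)) ∧ W t = w := by
  let e : FixedPointExtension u x hx := ⟨w, t⟩
  have hone : e ^ orderOf t = 1 := by
    rw [FixedPointExtension.pow_eq, hw, mul_inv_cancel, pow_orderOf_eq_one]
    rfl
  have hsnd : ∀ k : ℤ, (e ^ k).snd = t ^ k := fun k =>
    map_zpow (FixedPointExtension.sndHom u x hx) e k
  have hinj : ∀ a b : ℤ, t ^ a = t ^ b → e ^ a = e ^ b := by
    intro a b hab
    have h1 : t ^ (a - b) = 1 := by rw [zpow_sub, hab, mul_inv_cancel]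
    obtain ⟨c, hc⟩ := orderOf_dvd_iff_zpow_eq_one.2 h1
    have h2 : e ^ (a - b) = 1 := by rw [hc, zpow_mul, zpow_natCast, hone, one_zpow]
    rwa [zpow_sub, mul_inv_eq_one] at h2
  choose k hk using fun g => Subgroup.mem_zpowers_iff.1 (ht g)
  refine ⟨fun g => (e ^ k g).fst, fun s r => ?_, ?_⟩
  · have h : e ^ k s * e ^ k r = e ^ k (s * r) := by
      rw [← zpow_add]
      refine hinj _ _ ?_
      rw [zpow_add, hk, hk, hk]
    have h2 := congrArg FixedPointExtension.fst h
    rw [FixedPointExtension.mul_fst, hsnd, hsnd, hk, hk] at h2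
    change (e ^ k s).fst * (e ^ k r).fst = u.toFun s r x * (e ^ k (s * r)).fst
    rw [← h2, mul_comm (u.toFun s r x), inv_mul_cancel_right]
  · have h : e ^ k t = e := by
      rw [hinj (k t) 1 (by rw [hk, zpow_one]), zpow_one]
    change (e ^ k t).fst = w
    rw [h]

/-- Dividing by `c(x₀)` moves the branch cut of the argument away from the value at `x₀`. The root
exists everywhere, but is continuous only where the cut is avoided. For `n = 0`, division by zero
makes `w` constantly `1`. -/
lemma exists_local_root (c : C(X, Circle)) (x₀ : X) (n : ℕ) (hn : n = 0 → c = 1) :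
    ∃ (V : Set X) (w : X → Circle), IsOpen V ∧ x₀ ∈ V ∧ (∀ x ∈ V, ContinuousAt w x) ∧
      ∀ x, w x ^ n = c x := by
  let q : X → Circle := fun x => c x / c x₀
  have hq : Continuous fun x => (q x : ℂ) := by fun_prop
  refine ⟨{x | (q x : ℂ) ∈ Complex.slitPlane},
    fun x => Circle.exp ((Complex.arg (q x) + Complex.arg (c x₀)) / n), ?_, ?_, fun x hx => ?_,
    fun x => ?_⟩
  · exact Complex.isOpen_slitPlane.preimage hq
  · simp [q]
  · have h1 : ContinuousAt (fun y => Complex.arg (q y)) x :=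
      ContinuousAt.comp (f := fun y => (q y : ℂ)) (Complex.continuousAt_arg hx)
        hq.continuousAt
    exact Circle.exp.continuous.continuousAt.comp ((h1.add continuousAt_const).div_const _)
  · by_cases h0 : n = 0
    · rw [hn h0, h0, pow_zero]; rfl
    · have h0' : (n : ℝ) ≠ 0 := Nat.cast_ne_zero.2 h0
      have h2 : ∀ (r : ℝ) (m : ℕ), Circle.exp r ^ m = Circle.exp (m * r) := by
        intro r m
        induction m with
        | zero => simp
        | succ m ih => rw [pow_succ, ih, ← Circle.exp_add]; push_cast; ring_nf
      rw [h2, mul_div_cancel₀ _ h0', Circle.exp_add, Circle.exp_arg, Circle.exp_arg,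
        div_mul_cancel]

/-! ### Characters at fixed points -/

/-- If `A > B > 0`, the powers of `A / B` outgrow every linear bound. -/
lemma le_of_pow_le_mul_pow {A B C : ℝ} (hB : 0 ≤ B)
    (h : ∀ n : ℕ, 1 ≤ n → A ^ n ≤ (C * n + 1) * B ^ n) : A ≤ B := by
  by_contra! hlt
  rcases hB.eq_or_lt with rfl | hB
  · have h1 := h 1 le_rfl
    simp only [pow_one, mul_zero] at h1
    linarith
  have hr : 1 < A / B := (one_lt_div hB).2 hlt
  have hlim : Tendsto (fun n : ℕ => C * ((n : ℝ) ^ 1 / (A / B) ^ n) + (n : ℝ) ^ 0 / (A / B) ^ n)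
      atTop (𝓝 (C * 0 + 0)) :=
    ((tendsto_pow_const_div_const_pow_of_one_lt 1 hr).const_mul C).add
      (tendsto_pow_const_div_const_pow_of_one_lt 0 hr)
  have hge : (1 : ℝ) ≤ C * 0 + 0 := by
    refine ge_of_tendsto hlim ?_
    filter_upwards [eventually_ge_atTop 1] with n hn
    have h1 : (A / B) ^ n ≤ C * n + 1 := by
      rw [div_pow, div_le_iff₀ (pow_pos hB n)]
      exact h n hn
    have hp : 0 < (A / B) ^ n := pow_pos (zero_lt_one.trans hr) n
    rw [pow_one, pow_zero, ← mul_div_assoc, ← add_div, one_le_div hp]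
    exact h1
  norm_num at hge

namespace UniversalAlgebra

lemma summable_twistedEval (x : X) (W : G → Circle) (b : UniversalAlgebra u) :
    Summable fun s => b s x * (W s : ℂ) :=
  Summable.of_norm_bounded b.summable_norm fun s => by
    rw [norm_mul, Circle.norm_coe, mul_one]
    exact norm_apply_le _ _

/-- The functional `b ↦ ∑_s b(s)(x) W(s)`. -/
def twistedEval (u : Twist G X) (x : X) (W : G → Circle) : UniversalAlgebra u →L[ℂ] ℂ :=
  LinearMap.mkContinuous
    { toFun := fun b => ∑' s, b s x * (W s : ℂ)
      map_add' := fun a b => by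
        rw [← (summable_twistedEval x W a).tsum_add (summable_twistedEval x W b)]
        exact tsum_congr fun s => add_mul _ _ _
      map_smul' := fun c b => by
        rw [RingHom.id_apply, ← (summable_twistedEval x W b).tsum_const_smul c]
        exact tsum_congr fun s => mul_assoc _ _ _ } 1
    (fun b => by
      rw [one_mul, norm_eq]
      refine tsum_of_norm_bounded b.summable_norm.hasSum fun s => ?_
      rw [norm_mul, Circle.norm_coe, mul_one]
      exact norm_apply_le _ _)

lemma twistedEval_apply (x : X) (W : G → Circle) (b : UniversalAlgebra u) :
    twistedEval u x W b = ∑' s, b s x * (W s : ℂ) := rfl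

lemma twistedEval_single (x : X) (W : G → Circle) (s : G) (a : C₀(X, ℂ)) :
    twistedEval u x W (single u s a) = a x * (W s : ℂ) := by
  rw [twistedEval_apply, tsum_eq_single s, single_apply_self]
  intro r hr
  rw [single_apply_ne a hr, ZeroAtInftyContinuousMap.zero_apply, zero_mul]

/-- Both sides are bounded and bilinear, so it suffices to check `aδ_s` and `bδ_t`. There `α_s` is
invisible at the fixed point, and `W` absorbs the twist. -/
lemma twistedEval_mul {x : X} (hx : ∀ g : G, g • x = x) {W : G → Circle}
    (hW : ∀ s r, W s * W r = u.toFun s r x * W (s * r)) (a b : UniversalAlgebra u) :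
    twistedEval u x W (a * b) = twistedEval u x W a * twistedEval u x W b := by
  let L₁ : UniversalAlgebra u →L[ℂ] UniversalAlgebra u →L[ℂ] ℂ :=
    ((ContinuousLinearMap.compL ℂ (UniversalAlgebra u) (UniversalAlgebra u) ℂ)
      (twistedEval u x W)).comp (mulBilin u)
  let L₂ : UniversalAlgebra u →L[ℂ] UniversalAlgebra u →L[ℂ] ℂ :=
    (ContinuousLinearMap.mul ℂ ℂ).bilinearComp (twistedEval u x W) (twistedEval u x W)
  have h₁ : ∀ a b, L₁ a b = twistedEval u x W (a * b) := fun _ _ => rfl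
  have h₂ : ∀ a b, L₂ a b = twistedEval u x W a * twistedEval u x W b := fun _ _ => rfl
  rw [← h₁, ← h₂]
  congr 2
  refine hom_ext fun s a => hom_ext fun t b => ?_
  rw [h₁, h₂, single_mul_single, twistedEval_single, twistedEval_single, twistedEval_single,
    coeffMul_apply, hx]
  have h := congrArg (fun z : Circle => (z : ℂ)) (hW s t)
  simp only [Circle.coe_mul] at h
  linear_combination (-(a x * b x)) * h

/-- The coefficients of `b` are supported on the powers `t^i` with `|i| ≤ m`. -/
def SupportedOnPowers (t : G) (b : UniversalAlgebra u) (m : ℕ) : Prop :=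
  ∀ r, (∀ i : ℤ, |i| ≤ m → r ≠ t ^ i) → b r = 0

lemma SupportedOnPowers.mul {t : G} {a b : UniversalAlgebra u} {m n : ℕ}
    (ha : SupportedOnPowers t a m) (hb : SupportedOnPowers t b n) :
    SupportedOnPowers t (a * b) (m + n) := by
  intro r hr
  rw [mul_apply]
  refine (tsum_congr fun s => ?_).trans tsum_zero
  by_cases hs : ∃ i : ℤ, |i| ≤ m ∧ s = t ^ i
  · obtain ⟨i, hi, rfl⟩ := hs
    rw [hb]
    · ext x; simp
    · intro j hj h
      refine hr (i + j) ((abs_add_le _ _).trans (by push_cast; exact add_le_add hi hj)) ?_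
      rw [zpow_add, ← h, mul_inv_cancel_left]
  · rw [ha s fun i hi h => hs ⟨i, hi, h⟩]
    ext x; simp

lemma exists_supportedOnPowers_truncate {t : G} (ht : ∀ g, g ∈ Subgroup.zpowers t)
    (b : UniversalAlgebra u) (F : Finset G) : ∃ m, SupportedOnPowers t (b.truncate F) m := by
  choose k hk using fun g => Subgroup.mem_zpowers_iff.1 (ht g)
  refine ⟨∑ s ∈ F, (k s).natAbs, fun r hr => truncate_apply_of_notMem b fun hrF => ?_⟩
  refine hr (k r) ?_ (hk r).symm
  rw [Int.abs_eq_natAbs, Nat.cast_le]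
  exact Finset.single_le_sum (f := fun s => (k s).natAbs) (fun _ _ => Nat.zero_le _) hrF

/-- At most `2m + 1` group elements contribute, each by at most `N b`. This crude bound is sharpened
below by passing to powers. -/
lemma SupportedOnPowers.norm_twistedEval_le {N : AlgSeminorm u} (hN : N.DominatesCoefficients)
    (x : X) (W : G → Circle) {t : G} {b : UniversalAlgebra u} {m : ℕ}
    (hb : SupportedOnPowers t b m) : ‖twistedEval u x W b‖ ≤ (2 * m + 1) * N b := by
  classical
  let F : Finset G := (Finset.Icc (-(m : ℤ)) m).image (t ^ ·)
  have hF : F.card ≤ 2 * m + 1 := by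
    refine Finset.card_image_le.trans ?_
    rw [Int.card_Icc]
    omega
  rw [twistedEval_apply, tsum_eq_sum (s := F)]
  · calc _ ≤ ∑ s ∈ F, ‖b s x * (W s : ℂ)‖ := norm_sum_le _ _
      _ ≤ ∑ s ∈ F, N b := Finset.sum_le_sum fun s _ => by
          rw [norm_mul, Circle.norm_coe, mul_one]
          exact (norm_apply_le _ _).trans (hN b s)
      _ = F.card * N b := by rw [Finset.sum_const, nsmul_eq_mul]
      _ ≤ (2 * m + 1) * N b := mul_le_mul_of_nonneg_right (by exact_mod_cast hF) (N.nonneg b)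
  · intro s hs
    rw [hb s, ZeroAtInftyContinuousMap.zero_apply, zero_mul]
    rintro i hi rfl
    exact hs (Finset.mem_image_of_mem _ (Finset.mem_Icc.2 (abs_le.1 hi)))

/-- By density let `d` be supported on `t^i` with `|i| ≤ m`. Then `dⁿ` is supported on `|i| ≤ mn`,
so the character `χ` satisfies `|χ(d)|ⁿ = |χ(dⁿ)| ≤ (2mn + 1) N(d)ⁿ`, and the linear factor
disappears under `n`-th roots. -/
lemma norm_twistedEval_le {N : AlgSeminorm u} (hN : N.DominatesCoefficients) {t : G}
    (ht : ∀ g, g ∈ Subgroup.zpowers t) {x : X} (hx : ∀ g : G, g • x = x) {W : G → Circle}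
    (hW : ∀ s r, W s * W r = u.toFun s r x * W (s * r)) (b : UniversalAlgebra u) :
    ‖twistedEval u x W b‖ ≤ N b := by
  have hclosed : IsClosed {b | ‖twistedEval u x W b‖ ≤ ‖BanachCompletion.of N b‖} :=
    isClosed_le (twistedEval u x W).continuous.norm (BanachCompletion.of N).continuous.norm
  rw [← BanachCompletion.norm_of]
  refine hclosed.mem_of_tendsto (tendsto_truncate b) (Eventually.of_forall fun F => ?_)
  change ‖twistedEval u x W (b.truncate F)‖ ≤ ‖BanachCompletion.of N (b.truncate F)‖
  rw [BanachCompletion.norm_of]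
  obtain ⟨m, hm⟩ := exists_supportedOnPowers_truncate ht b F
  set d := b.truncate F
  -- Here `y n` is the power `d^(n+1)`; the algebra need not have a unit, so there is no zeroth
  -- power.
  let y : ℕ → UniversalAlgebra u := fun n => (d * ·)^[n] d
  have hy : ∀ n, y (n + 1) = d * y n := fun n => Function.iterate_succ_apply' _ _ _
  have hsupp : ∀ n, SupportedOnPowers t (y n) (m * (n + 1)) := by
    intro n
    induction n with
    | zero => simpa [y] using hm
    | succ n ih =>
      rw [hy]
      have h := hm.mul ih
      rwa [← mul_one_add, add_comm 1] at h
  have heval : ∀ n, twistedEval u x W (y n) = twistedEval u x W d ^ (n + 1) := by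
    intro n
    induction n with
    | zero => simp [y]
    | succ n ih => rw [hy, twistedEval_mul hx hW, ih, pow_succ' _ (n + 1)]
  have hnorm : ∀ n, N (y n) ≤ N d ^ (n + 1) := by
    intro n
    induction n with
    | zero => simp [y]
    | succ n ih =>
      rw [hy, pow_succ' _ (n + 1)]
      exact (N.mul_le _ _).trans (mul_le_mul_of_nonneg_left ih (N.nonneg d))
  refine le_of_pow_le_mul_pow (C := 2 * m) (N.nonneg d) fun n hn => ?_
  obtain ⟨n, rfl⟩ := Nat.exists_eq_add_of_le' hn
  rw [← norm_pow, ← heval]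
  refine ((hsupp n).norm_twistedEval_le hN x W).trans ?_
  push_cast
  rw [← mul_assoc]
  exact mul_le_mul_of_nonneg_left (hnorm n) (by positivity)

end UniversalAlgebra

/-! ### Ideals over open sets of fixed points -/

namespace BanachCompletion

open UniversalAlgebra

variable {N : AlgSeminorm u}

lemma lift_twistedEval_mul {x : X} (hx : ∀ g : G, g • x = x) {W : G → Circle}
    (hW : ∀ s r, W s * W r = u.toFun s r x * W (s * r))
    (hle : ∀ b, ‖(twistedEval u x W).toLinearMap b‖ ≤ N b) (c d : BanachCompletion N) :
    lift (twistedEval u x W).toLinearMap hle (c * d) =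
      lift (twistedEval u x W).toLinearMap hle c * lift (twistedEval u x W).toLinearMap hle d := by
  refine induction_on c ?_ fun a => ?_
  · exact isClosed_eq (by fun_prop) (by fun_prop)
  refine induction_on d ?_ fun b => ?_
  · exact isClosed_eq (by fun_prop) (by fun_prop)
  rw [← of_mul, lift_of, lift_of, lift_of]
  exact twistedEval_mul hx hW a b

/-- The ideal consists of the elements whose coefficients vanish off an open set of fixed points and
which are killed by one character at each point of that set. -/
lemma exists_ideal_of_fixed [LocallyCompactSpace X] [T2Space X] (hN : N.DominatesCoefficients)
    {t : G} (ht : ∀ g, g ∈ Subgroup.zpowers t) (ht1 : t ≠ 1) {U : Set X} (hU : IsOpen U)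
    (hne : U.Nonempty) (hfix : ∀ x ∈ U, t • x = x) :
    ∃ J : Submodule ℂ (BanachCompletion N), IsBanachIdeal J ∧ J ⊓ coefficients N = ⊥ ∧
      ∃ b : UniversalAlgebra u, b ≠ 0 ∧ of N b ∈ J := by
  obtain ⟨x₀, hx₀⟩ := hne
  obtain ⟨V, w, hV, hx₀V, hwc, hw⟩ := exists_local_root
    (∏ j ∈ Finset.range (orderOf t), u.toFun (t ^ j) t) x₀ (orderOf t) fun h => by rw [h]; rfl
  have hfix' : ∀ x ∈ U ∩ V, ∀ g : G, g • x = x := by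
    intro x hx g
    have h : t ∈ MulAction.stabilizer G x := hfix x hx.1
    exact (Subgroup.zpowers_le.2 h) (ht g)
  -- The complement of a set of fixed points is invariant. This makes the vanishing condition on
  -- coefficients stable under left multiplication, which translates points.
  have hcompl : ∀ x ∉ U ∩ V, ∀ g : G, g • x ∉ U ∩ V := by
    intro x hx g hgx
    refine hx ?_
    have h := hfix' _ hgx g⁻¹
    rw [inv_smul_smul] at h
    rwa [← h] at hgx
  have htriv : ∀ x (hx : x ∈ U ∩ V), ∃ W : G → Circle,
      (∀ s r, W s * W r = u.toFun s r x * W (s * r)) ∧ W t = w x := fun x hx =>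
    exists_trivialisation u (hfix' x hx) ht (by rw [hw, ContinuousMap.prod_apply])
  choose W hW hWt using htriv
  have hW1 : ∀ x hx, W x hx 1 = 1 := fun x hx => by
    have h := hW x hx 1 1
    rw [u.one_left, one_mul, mul_one] at h
    exact mul_eq_left.1 h
  have hle : ∀ x hx, ∀ b, ‖(twistedEval u x (W x hx)).toLinearMap b‖ ≤ N b := fun x hx =>
    norm_twistedEval_le hN ht (hfix' x hx) (hW x hx)
  let J : Submodule ℂ (BanachCompletion N) :=
    { carrier := {c | (∀ x hx, lift _ (hle x hx) c = 0) ∧ ∀ s, ∀ x ∉ U ∩ V, coeff hN s c x = 0}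
      zero_mem' := ⟨fun x hx => map_zero _, fun s x _ => by rw [map_zero]; rfl⟩
      add_mem' := fun {c d} hc hd =>
        ⟨fun x hx => by rw [map_add, hc.1 x hx, hd.1 x hx, add_zero], fun s x hx => by
          rw [map_add, ZeroAtInftyContinuousMap.add_apply, hc.2 s x hx, hd.2 s x hx, add_zero]⟩
      smul_mem' := fun z c hc =>
        ⟨fun x hx => by rw [map_smul, hc.1 x hx, smul_zero], fun s x hx => by
          rw [map_smul, ZeroAtInftyContinuousMap.smul_apply, hc.2 s x hx, smul_zero]⟩ }
  have hJ : ∀ c, c ∈ J ↔ (∀ x hx, lift _ (hle x hx) c = 0) ∧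
      ∀ s, ∀ x ∉ U ∩ V, coeff hN s c x = 0 := fun _ => Iff.rfl
  refine ⟨J, isBanachIdeal_of_single ?_ ?_ ?_, ?_, ?_⟩
  · have : (J : Set (BanachCompletion N)) = (⋂ (x) (hx), {c | lift _ (hle x hx) c = 0}) ∩
        ⋂ (s) (x) (_ : x ∉ U ∩ V), {c | coeff hN s c x = 0} := by
      ext c
      simp only [Set.mem_inter_iff, Set.mem_iInter]
      exact hJ c
    rw [this]
    refine IsClosed.inter ?_ ?_
    · exact isClosed_iInter fun x => isClosed_iInter fun hx =>
        isClosed_eq (lift _ (hle x hx)).continuous continuous_const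
    · exact isClosed_iInter fun s => isClosed_iInter fun x => isClosed_iInter fun _ =>
        isClosed_eq (continuous_coeff_apply hN s x) continuous_const
  · intro s a c hc
    rw [hJ] at hc ⊢
    refine ⟨fun x hx => ?_, fun r x hx => ?_⟩
    · rw [lift_twistedEval_mul (hfix' x hx) (hW x hx), hc.1 x hx, mul_zero]
    · rw [coeff_single_mul, hc.2 _ _ (hcompl x hx _), mul_zero, zero_mul]
  · intro s a c hc
    rw [hJ] at hc ⊢
    refine ⟨fun x hx => ?_, fun r x hx => ?_⟩
    · rw [lift_twistedEval_mul (hfix' x hx) (hW x hx), hc.1 x hx, zero_mul]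
    · rw [coeff_mul_single, hc.2 _ _ hx, zero_mul, zero_mul]
  · refine eq_bot_iff.2 ?_
    rintro _ ⟨hc, a, rfl⟩
    change of N (single u 1 a) ∈ J at hc
    rw [hJ] at hc
    -- On `U ∩ V` the character at `x` sends `aδ_1` to `a(x)`, since `W(1) = 1`; off `U ∩ V` the
    -- coefficient condition applies.
    have ha : a = 0 := by
      ext x
      by_cases hx : x ∈ U ∩ V
      · have h := hc.1 x hx
        rw [lift_of] at h
        change twistedEval u x (W x hx) (single u 1 a) = 0 at h
        rwa [twistedEval_single, hW1, Circle.coe_one, mul_one] at h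
      · have h := hc.2 1 x hx
        rwa [coeff_of, single_apply_self] at h
    rw [ha, map_zero]
    exact Submodule.zero_mem _
  · obtain ⟨a, V', -, hx₀V', -, ha1, haU, hac, -⟩ := exists_bump (hU.inter hV) ⟨hx₀, hx₀V⟩
    have ha0 : ∀ x ∉ U ∩ V, a x = 0 := fun x hx =>
      image_eq_zero_of_notMem_tsupport fun h => hx (haU h)
    have hsupp : tsupport (fun x => a x * (w x : ℂ)) ⊆ tsupport a :=
      closure_mono fun x hx hx' => hx (by change a x * _ = 0; rw [hx', zero_mul])
    -- The root `w` need only be continuous on `V`, which contains the support of `a`.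
    let aw : C(X, ℂ) := ⟨fun x => a x * (w x : ℂ), continuous_of_tsupport fun x hx =>
      (map_continuous a).continuousAt.mul
        ((by fun_prop : Continuous fun z : Circle => (z : ℂ)).continuousAt.comp (hwc x (haU (hsupp hx)).2))⟩
    have hawc : HasCompactSupport aw :=
      hac.of_isClosed_subset (isClosed_tsupport _) hsupp
    let a' : C₀(X, ℂ) := ⟨aw, hawc.is_zero_at_infty⟩
    have ha' : ∀ x, a' x = a x * (w x : ℂ) := fun _ => rfl
    -- The characters take the value `a(x)w(x)` on both terms because `W(t) = w(x)`. The difference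
    -- is non-zero because `t ≠ 1` keeps the two terms apart.
    refine ⟨single u t a - single u 1 a', fun h => ?_, (hJ _).2 ⟨fun x hx => ?_, fun s x hx => ?_⟩⟩
    · have h2 := congrArg (fun d : UniversalAlgebra u => d t x₀) h
      simp only [UniversalAlgebra.sub_apply, single_apply_self, single_apply_ne a' ht1,
        UniversalAlgebra.zero_apply,
        ZeroAtInftyContinuousMap.zero_apply, sub_zero, ha1 x₀ hx₀V'] at h2
      exact one_ne_zero h2
    · rw [lift_of]
      change twistedEval u x (W x hx) _ = 0
      rw [map_sub, twistedEval_single, twistedEval_single, hWt, hW1, ha', Circle.coe_one, mul_one,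
        sub_self]
    · rw [coeff_of, UniversalAlgebra.sub_apply]
      have h1 : ∀ r (d : C₀(X, ℂ)), d x = 0 → single u r d s x = 0 := by
        intro r d hd
        by_cases hs : s = r
        · rw [hs, single_apply_self, hd]
        · rw [single_apply_ne d hs, ZeroAtInftyContinuousMap.zero_apply]
      rw [ZeroAtInftyContinuousMap.sub_apply, h1 t a (ha0 x hx),
        h1 1 a' (by rw [ha', ha0 x hx, zero_mul]), sub_zero]

end BanachCompletion

/-! ### The main theorem -/

lemma IsTopologicallyFree.restrict (h : IsTopologicallyFree G X) (H : Subgroup G) :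
    IsTopologicallyFree H X := fun t ht =>
  h t fun h1 => ht (Subtype.ext h1)

lemma exists_cyclic_of_not_isTopologicallyFree (h : ¬ IsTopologicallyFree G X) :
    ∃ (H : Subgroup G) (t : H) (U : Set X), IsCyclic H ∧ (∀ g, g ∈ Subgroup.zpowers t) ∧ t ≠ 1 ∧
      IsOpen U ∧ U.Nonempty ∧ ∀ x ∈ U, t • x = x := by
  simp only [IsTopologicallyFree, not_forall] at h
  obtain ⟨t, ht, hU⟩ := h
  refine ⟨Subgroup.zpowers t, ⟨t, Subgroup.mem_zpowers t⟩, interior {x : X | t • x = x},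
    inferInstance, ?_, fun h => ht (congrArg Subtype.val h), isOpen_interior,
    Set.nonempty_iff_ne_empty.2 hU, fun x hx => interior_subset (s := {x : X | t • x = x}) hx⟩
  rintro ⟨g, hg⟩
  obtain ⟨k, rfl⟩ := Subgroup.mem_zpowers_iff.1 hg
  exact Subgroup.mem_zpowers_iff.2 ⟨k, Subtype.ext (by simp)⟩

open BanachCompletion UniversalAlgebra

/-- Hence `ker Λ_P` consists of elements with all coefficients zero, and contains every such element
by `reduced_eq_zero_of_coeff_eq_zero`. -/
lemma coeff_regularMap [LocallyCompactSpace X] [T2Space X] (P : Set Exponent)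
    (c : FullCrossedProduct u P) (s : G) :
    coeff (dominatesCoefficients_reducedNorm u P) s (regularMap u P c) =
      coeff (dominatesCoefficients_fullNorm u P) s c := by
  refine induction_on c ?_ fun b => ?_
  · exact isClosed_eq (by fun_prop) (by fun_prop)
  · rw [regularMap, canonicalMap_of, coeff_of, coeff_of]

lemma detectsIdeals_of_isTopologicallyFree [LocallyCompactSpace X] [T2Space X]
    (u : Twist G X) (P : Set Exponent) (hfree : IsTopologicallyFree G X) :
    DetectsIdeals (coefficients (reducedNorm u P)) := fun _ hJ hne hJA =>
  hne <| eq_bot_iff.2 fun c hc => reduced_eq_zero_of_coeff_eq_zero P c fun s =>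
    coeff_eq_zero_of_mem (dominatesCoefficients_reducedNorm u P) hfree hJ hJA hc s

lemma hasGeneralisedIntersectionProperty_of_isTopologicallyFree [LocallyCompactSpace X]
    [T2Space X] (u : Twist G X) (P : Set Exponent) (hfree : IsTopologicallyFree G X) :
    HasGeneralisedIntersectionProperty (coefficients (fullNorm u P))
      (LinearMap.ker (regularMap u P).toLinearMap) := by
  refine ⟨⟨⟨?_, fun b c hc => ?_, fun b c hc => ?_⟩, ?_⟩, ?_⟩
  · exact isClosed_singleton.preimage (regularMap u P).continuous
  · change regularMap u P (b * c) = 0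
    rw [regularMap, canonicalMap_mul]
    exact (congrArg _ (show regularMap u P c = 0 from hc)).trans (mul_zero _)
  · change regularMap u P (c * b) = 0
    rw [regularMap, canonicalMap_mul]
    exact (congrArg (· * _) (show regularMap u P c = 0 from hc)).trans (zero_mul _)
  · refine eq_bot_iff.2 ?_
    rintro _ ⟨hc, a, rfl⟩
    have h := coeff_regularMap P (of (fullNorm u P) (single u 1 a)) 1
    rw [show regularMap u P (of (fullNorm u P) (single u 1 a)) = 0 from hc, map_zero, coeff_of,
      single_apply_self] at h
    rw [← h, map_zero]
    exact Submodule.zero_mem _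
  · rintro J ⟨hJ, hJA⟩ c hc
    refine reduced_eq_zero_of_coeff_eq_zero P _ fun s => ?_
    exact (coeff_regularMap P c s).trans
      (coeff_eq_zero_of_mem (dominatesCoefficients_fullNorm u P) hfree hJ hJA hc s)

lemma of_ne_zero {N : AlgSeminorm u} (hN : N.DominatesCoefficients) {b : UniversalAlgebra u}
    (hb : b ≠ 0) : of N b ≠ 0 := fun h => hb <| UniversalAlgebra.ext fun s => by
  rw [← coeff_of hN, h, map_zero]; rfl

lemma isTopologicallyFree_of_detectsIdeals [LocallyCompactSpace X] [T2Space X] (u : Twist G X)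
    (P : Set Exponent) (h : ∀ H : Subgroup G, IsCyclic H →
      DetectsIdeals (coefficients (reducedNorm (u.restrict H) P))) : IsTopologicallyFree G X := by
  by_contra hfree
  obtain ⟨H, t, U, hH, ht, ht1, hU, hne, hfix⟩ := exists_cyclic_of_not_isTopologicallyFree hfree
  have hN := dominatesCoefficients_reducedNorm (u.restrict H) P
  obtain ⟨J, hJ, hJA, b, hb, hbJ⟩ := exists_ideal_of_fixed hN ht ht1 hU hne hfix
  exact h H hH J hJ ((Submodule.ne_bot_iff J).2 ⟨_, hbJ, of_ne_zero hN hb⟩) hJA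

lemma isTopologicallyFree_of_hasGeneralisedIntersectionProperty [LocallyCompactSpace X]
    [T2Space X] (u : Twist G X) (P : Set Exponent)
    (h : ∀ H : Subgroup G, HasGeneralisedIntersectionProperty
      (coefficients (fullNorm (u.restrict H) P))
      (LinearMap.ker (regularMap (u.restrict H) P).toLinearMap)) : IsTopologicallyFree G X := by
  by_contra hfree
  obtain ⟨H, t, U, hH, ht, ht1, hU, hne, hfix⟩ := exists_cyclic_of_not_isTopologicallyFree hfree
  have hN := dominatesCoefficients_fullNorm (u.restrict H) P
  obtain ⟨J, hJ, hJA, b, hb, hbJ⟩ := exists_ideal_of_fixed hN ht ht1 hU hne hfix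
  -- Maximality of the hidden ideal forces `b` into `ker Λ_P`, although `Λ_P` is injective on
  -- `F(α,u)`.
  have h1 : regularMap (u.restrict H) P (of _ b) = 0 := (h H).2 ⟨hJ, hJA⟩ hbJ
  rw [regularMap, canonicalMap_of] at h1
  exact of_ne_zero (dominatesCoefficients_reducedNorm (u.restrict H) P) hb h1

end TwistedCrossedProduct

end

theorem mainTheorem2 {G X : Type*} [Group G] [TopologicalSpace X] [LocallyCompactSpace X]
    [T2Space X] [MulAction G X] [ContinuousConstSMul G X] (u : Twist G X) (P : Set Exponent) :
    List.TFAE [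
      IsTopologicallyFree G X,
      ∀ H : Subgroup G, HasGeneralisedIntersectionProperty
        (BanachCompletion.coefficients (fullNorm (u.restrict H) P))
        (LinearMap.ker (regularMap (u.restrict H) P).toLinearMap),
      ∀ H : Subgroup G,
        DetectsIdeals (BanachCompletion.coefficients (reducedNorm (u.restrict H) P)),
      ∀ H : Subgroup G, IsCyclic H →
        DetectsIdeals (BanachCompletion.coefficients (reducedNorm (u.restrict H) P))] := by
  -- Topological freeness passes to subgroups, which is why conditions 2 and 3 hold for every `H`.
  -- Cyclic subgroups suffice for the converse, since failure of freeness is witnessed by a single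
  -- element.
  tfae_have 1 → 2 := fun h H =>
    hasGeneralisedIntersectionProperty_of_isTopologicallyFree (u.restrict H) P (h.restrict H)
  tfae_have 1 → 3 := fun h H =>
    detectsIdeals_of_isTopologicallyFree (u.restrict H) P (h.restrict H)
  tfae_have 3 → 4 := fun h H _ => h H
  tfae_have 4 → 1 := isTopologicallyFree_of_detectsIdeals u P
  tfae_have 2 → 1 := isTopologicallyFree_of_hasGeneralisedIntersectionProperty u P
  tfae_finish
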